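/- Let $\Gamma$ be a discrete group. A $\Gamma$-space is a compact Hausdorff space with an action of $\Gamma$ by homeomorphisms; it is minimal if every orbit is dense. For a group $G$, a factor map of $G$-spaces is a $G$-equivariant continuous surjection. A factor map $\pi_Y\colon Y\to X$ is a strongly proximal extension if for every regular Borel probability measure $\nu$ on $Y$ whose support is contained in a fibre $\pi_Y^{-1}(x)$, $x\in X$, some Dirac measure $\delta_y$ ($y\in Y$) lies in the weak-$*$ closure of the orbit $G\nu$. A $(G,X)$-boundary is a pair $(Y,\pi_Y)$ in which $Y$ is a minimal $G$-space and $\pi_Y\colon Y\to X$ is a strongly proximal extension. The generalized Furstenberg boundary $(\partial_F(G,X),\pi_G)$ is the $(G,X)$-boundary with the property that for every $(G,X)$-boundary $(Y,\pi_Y)$ there is a unique factor map $\Phi\colon\partial_F(G,X)\to Y$ with $\pi_Y\circ\Phi=\pi_G$. A subgroup $H\le\Gamma$ is commensurated if $[H:H\cap gHg^{-1}]<\infty$ for every $g\in\Gamma$. **Theorem.** Let $X$ be a $\Gamma$-space and let $H\le\Gamma$ be a commensurated subgroup such that $X$ is minimal as an $H$-space and the action of $H$ on $\partial_F(H,X)$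 is free (no element of $H\setminus\{e\}$ fixes a point). Then there is a unique action $(T_g)_{g\in\Gamma}$ of $\Gamma$ on $\partial_F(H,X)$ by homeomorphisms such that $T_h(y)=hy$ for all $h\in H$, $y\in\partial_F(H,X)$, and $\pi_H(T_g(y))=g\,\pi_H(y)$ for all $g\in\Gamma$, $y\in\partial_F(H,X)$. For $g\in\Gamma$ put $\mathrm{Fix}(g)=\{y\in\partial_F(H,X):T_g(y)=y\}$ and $K_g=H\cap g^{-1}Hg$, and, when $\mathrm{Fix}(g)\neq\emptyset$, let $L_g\le K_g$ be the subgroup generated by the return times $\{k\in K_g: k\,\mathrm{Fix}(g)\cap\mathrm{Fix}(g)\ne\emptyset\}$. Then for every $g\in\Gamma$ exactly one of the following holds: 1. $\mathrm{Fix}(g)=\emptyset$; 2. $\mathrm{Fix}(g)\neq\emptyset$ and $g$ centralizes $L_g$, i.e. $g\in C_\Gamma(L_g)$. Moreover, for every $g\in\Gamma$ with $\mathrm{Fix}(g)\ne\emptyset$: - if $X$ is connected, then $L_g=K_g$; - if $g$ acts trivially on $X$, then $g\in C_\Gamma(L_g)$ implies $T_g=\mathrm{id}_{\partial_F(H,X)}$.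 -/

import Mathlib

open MeasureTheory
open scoped Pointwise

universe u

/-- `H` is commensurated in `Γ`: for every `g`, the subgroup `H ∩ gHg⁻¹` has finite index in `H`. -/
def IsCommensurated {Γ : Type u} [Group Γ] (H : Subgroup Γ) : Prop :=
  ∀ g : Γ, (H ⊓ MulAut.conj g • H).relIndex H ≠ 0

/-- Factor maps of `G`-spaces: equivariant continuous surjections. -/
structure IsFactorMap (G : Type u) [Group G] {Y X : Type u} [TopologicalSpace Y]
    [TopologicalSpace X] [MulAction G Y] [MulAction G X] (π : Y → X) : Prop where
  continuous : Continuous π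
  surjective : Function.Surjective π
  map_smul : ∀ (g : G) (y : Y), π (g • y) = g • π y

/-- Strong proximality of `π : Y → X`: whenever a regular Borel probability measure `ν` on `Y` is
supported in one fibre of `π`, some point mass lies in the weak closure of the orbit `Gν`. -/
def IsStronglyProximal (G : Type u) [Group G] {Y X : Type u} [TopologicalSpace Y]
    [MulAction G Y] [ContinuousConstSMul G Y] (π : Y → X) : Prop :=
  letI : MeasurableSpace Y := borel Y
  haveI : BorelSpace Y := ⟨rfl⟩
  ∀ ν : ProbabilityMeasure Y, (ν : Measure Y).Regular →
    ∀ x : X, (ν : Measure Y).support ⊆ π ⁻¹' {x} →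
      ∃ y : Y, diracProba y ∈
        closure (Set.range fun g : G => ν.map (measurable_const_smul g).aemeasurable)

/-- `(Y, π)` is a `(G, X)`-boundary: a minimal strongly proximal extension of the `G`-space `X`. -/
structure IsRelBoundary (G : Type u) [Group G] {Y X : Type u} [TopologicalSpace Y]
    [TopologicalSpace X] [MulAction G Y] [ContinuousConstSMul G Y] [MulAction G X]
    (π : Y → X) : Prop where
  factor : IsFactorMap G π
  minimal : MulAction.IsMinimal G Y
  stronglyProximal : IsStronglyProximal G π

/-- `(B, π)` is the generalized Furstenberg boundary `∂_F(G, X)`: a `(G, X)`-boundary which maps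
uniquely onto every `(G, X)`-boundary over `X`. As a minimal compact Hausdorff `G`-space contains a
dense copy of a quotient of `G`, every `(G, X)`-boundary has a copy in the universe of `G`, so
that testing against that universe loses nothing. -/
structure IsGenFurstenbergBoundary (G : Type u) [Group G] {B X : Type u} [TopologicalSpace B]
    [TopologicalSpace X] [MulAction G B] [ContinuousConstSMul G B] [MulAction G X]
    (π : B → X) : Prop where
  boundary : IsRelBoundary G π
  universal : ∀ (Y : Type u) [TopologicalSpace Y] [CompactSpace Y] [T2Space Y] [MulAction G Y]
    [ContinuousConstSMul G Y] (p : Y → X), IsRelBoundary G p →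
      ∃! Φ : B → Y, IsFactorMap G Φ ∧ p ∘ Φ = π

/-- `T` is an action of `Γ` on `B` by homeomorphisms which extends the action of `H` and for which
`π : B → X` is `Γ`-equivariant. -/
structure IsExtendedAction {Γ : Type u} [Group Γ] {B X : Type u} [TopologicalSpace B]
    (H : Subgroup Γ) [MulAction H B] [MulAction Γ X] (π : B → X) (T : Γ →* (B ≃ₜ B)) : Prop where
  extend : ∀ (h : H) (y : B), T h y = h • y
  equivariant : ∀ (g : Γ) (y : B), π (T g y) = g • π y

/-- The set `N_K(U)` of return times in `K` of a set `U`. -/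
def returnTimes {Γ : Type u} [Group Γ] {B : Type u} [TopologicalSpace B] (T : Γ →* (B ≃ₜ B))
    (K : Subgroup Γ) (U : Set B) : Set Γ :=
  {k | k ∈ K ∧ (T k '' U ∩ U).Nonempty}

/-- The group `L_K(U)` generated by the return times in `K` of `U`. -/
def returnTimeGroup {Γ : Type u} [Group Γ] {B : Type u} [TopologicalSpace B] (T : Γ →* (B ≃ₜ B))
    (K : Subgroup Γ) (U : Set B) : Subgroup Γ :=
  Subgroup.closure (returnTimes T K U)

/-- `Fix(T_g)`. -/
def fixSet {Γ : Type u} [Group Γ] {B : Type u} [TopologicalSpace B] (T : Γ →* (B ≃ₜ B)) (g : Γ) :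
    Set B :=
  {y | T g y = y}

/-- The subgroup `H ∩ g⁻¹Hg`. -/
def conjInter {Γ : Type u} [Group Γ] (H : Subgroup Γ) (g : Γ) : Subgroup Γ :=
  H ⊓ MulAut.conj g⁻¹ • H

/-! Regular probability measures are handled as states on `C(Y, ℝ)`, and strong proximality becomes
contraction of every state over a point of `X` to a point mass. Contraction survives passage to
finite-index subgroups, and commensuration lets it survive conjugation by elements of `Γ`.

Rigidity (`eq_of_contracting`): let two maps on a minimal space intertwine the same finite-index
actions and lie over the same base map. The average of their point masses at `b` contracts to a
point mass, which is extreme, so the maps agree somewhere in the orbit closure of `b`, hence at `b`.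
This gives uniqueness and multiplicativity of the extended action. Existence comes from the space of
`H`-equivariant maps `Γ → B` over orbit maps of `X`: it is contracting over `X`, so the boundary
maps to it, and evaluation at `g` defines `T g`.

The boundary is extremally disconnected, because a cover deciding on which side of an open set each
translate lies is again contracting and hence has a section. So `Fix(g)` is open. If `y` and `ky`
are fixed by `g`, with `k ∈ K_g`, then `gkg⁻¹y = ky`, and freeness gives `gkg⁻¹ = k`; thus `g`
always centralizes `L_g`. When `Fix(g)` is nonempty, openness and minimality give `L_g` finite index
in `H`. If `g` is trivial on `X`, rigidity compares `T g` with the identity. If `X` is connected,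
finite-index subgroups still act minimally on it, so `Fix(g)` maps onto `X`; then `g` is trivial on
`X`, `T g` is the identity, and every element of `K_g` is a return time. -/

/-! ### States on spaces of continuous functions -/

section States

variable {Y Z W : Type*} [TopologicalSpace Y] [TopologicalSpace Z] [TopologicalSpace W]

/-- The states of `C(Y, ℝ)`, with the topology of pointwise convergence. -/
def stateSpace (Y : Type*) [TopologicalSpace Y] : Set (C(Y, ℝ) → ℝ) :=
  {φ | (∀ f g, φ (f + g) = φ f + φ g) ∧ (∀ (c : ℝ) f, φ (c • f) = c * φ f) ∧
    (∀ f, 0 ≤ f → 0 ≤ φ f) ∧ φ 1 = 1}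

/-- The push-forward of a functional on `C(Y, ℝ)` along a continuous map. -/
def pushState (u : C(Y, Z)) (φ : C(Y, ℝ) → ℝ) : C(Z, ℝ) → ℝ := fun f => φ (f.comp u)

/-- The point evaluation, as a functional on `C(Y, ℝ)`. -/
def evalState (y : Y) : C(Y, ℝ) → ℝ := fun f => f y

/-- The points at which every nonnegative function annihilated by `φ` vanishes. -/
def stateSupport (φ : C(Y, ℝ) → ℝ) : Set Y := {y | ∀ f : C(Y, ℝ), 0 ≤ f → φ f = 0 → f y = 0}

theorem continuous_pushState (u : C(Y, Z)) : Continuous (pushState u) :=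
  continuous_pi fun f => continuous_apply (f.comp u)

theorem continuous_evalState : Continuous (evalState : Y → C(Y, ℝ) → ℝ) :=
  continuous_pi fun f => f.continuous

theorem pushState_mem {φ : C(Y, ℝ) → ℝ} (hφ : φ ∈ stateSpace Y) (u : C(Y, Z)) :
    pushState u φ ∈ stateSpace Z :=
  ⟨fun f g => hφ.1 (f.comp u) (g.comp u), fun c f => hφ.2.1 c (f.comp u),
    fun f hf => hφ.2.2.1 (f.comp u) fun y => hf (u y), hφ.2.2.2⟩

theorem pushState_pushState (u : C(Y, Z)) (v : C(Z, W)) (φ : C(Y, ℝ) → ℝ) :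
    pushState v (pushState u φ) = pushState (v.comp u) φ := rfl

theorem pushState_id (φ : C(Y, ℝ) → ℝ) : pushState (ContinuousMap.id Y) φ = φ := rfl

section

variable {φ : C(Y, ℝ) → ℝ} (hφ : φ ∈ stateSpace Y)
include hφ

theorem state_sub (f g : C(Y, ℝ)) : φ (f - g) = φ f - φ g := by
  have h := hφ.1 (f - g) g
  rw [sub_add_cancel] at h
  linarith

theorem state_mono {f g : C(Y, ℝ)} (h : f ≤ g) : φ f ≤ φ g := by
  have := hφ.2.2.1 (g - f) (sub_nonneg.2 h)
  rw [state_sub hφ] at this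
  linarith

theorem state_smul_one (c : ℝ) : φ (c • 1) = c := by rw [hφ.2.1, hφ.2.2.2, mul_one]

theorem state_zero : φ 0 = 0 := by simpa using hφ.2.1 0 0

theorem state_sum {ι : Type*} (s : Finset ι) (f : ι → C(Y, ℝ)) :
    φ (∑ i ∈ s, f i) = ∑ i ∈ s, φ (f i) := by
  classical
  induction s using Finset.induction_on with
  | empty => simpa using state_zero hφ
  | insert a s ha ih => rw [Finset.sum_insert ha, Finset.sum_insert ha, hφ.1, ih]

theorem state_mem_Icc [CompactSpace Y] (f : C(Y, ℝ)) : φ f ∈ Set.Icc (-‖f‖) ‖f‖ := by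
  constructor
  · rw [← state_smul_one hφ (-‖f‖)]
    refine state_mono hφ fun y => ?_
    simpa using neg_le_of_abs_le (f.norm_coe_le_norm y)
  · rw [← state_smul_one hφ ‖f‖]
    refine state_mono hφ fun y => ?_
    simpa using le_of_abs_le (f.norm_coe_le_norm y)

/-- A state is controlled by the values of functions on its support. -/
theorem state_le_of_forall_support_lt [CompactSpace Y] {f : C(Y, ℝ)} {ε : ℝ}
    (h : ∀ y ∈ stateSupport φ, f y < ε) : φ f ≤ ε := by
  classical
  have hC : IsCompact {y | ε ≤ f y} := (isClosed_le continuous_const f.continuous).isCompact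
  have hw : ∀ y ∈ {y | ε ≤ f y}, ∃ k : C(Y, ℝ), 0 ≤ k ∧ φ k = 0 ∧ 0 < k y := by
    intro y hy
    have : y ∉ stateSupport φ := fun hs => not_lt.2 hy (h y hs)
    simp only [stateSupport, Set.mem_ofPred_eq, not_forall] at this
    obtain ⟨k, hk, hk0, hky⟩ := this
    exact ⟨k, hk, hk0, lt_of_le_of_ne (hk y) (Ne.symm hky)⟩
  choose! k hk hk0 hky using hw
  obtain ⟨t, hcov⟩ := hC.elim_nhds_subcover' (fun y _ => {z | 0 < k y z})
    fun y hy => (isOpen_lt continuous_const (k y).continuous).mem_nhds (hky y hy)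
  · set s : C(Y, ℝ) := ∑ y ∈ t, k y with hs
    have hs0 : φ s = 0 := by
      rw [hs, state_sum hφ]
      exact Finset.sum_eq_zero fun y _ => hk0 y y.2
    have hsnn : ∀ z, 0 ≤ s z := fun z => by
      rw [hs, ContinuousMap.sum_apply]
      exact Finset.sum_nonneg fun y _ => hk y y.2 z
    have hspos : ∀ z ∈ {y | ε ≤ f y}, 0 < s z := by
      intro z hz
      obtain ⟨y, hyt, hyz⟩ := Set.mem_iUnion₂.1 (hcov hz)
      rw [hs, ContinuousMap.sum_apply]
      exact Finset.sum_pos' (fun y _ => hk y y.2 z) ⟨y, hyt, hyz⟩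
    obtain ⟨c, hc, hcs⟩ : ∃ c : ℝ, 0 < c ∧ ∀ z ∈ {y | ε ≤ f y}, c ≤ s z := by
      rcases Set.eq_empty_or_nonempty {y | ε ≤ f y} with he | hne
      · exact ⟨1, one_pos, fun z hz => absurd hz (he ▸ Set.notMem_empty z)⟩
      · obtain ⟨z, hz, hmin⟩ := hC.exists_isMinOn hne s.continuous.continuousOn
        exact ⟨s z, hspos z hz, fun w hw => hmin hw⟩
    -- Where `ε ≤ f`, the bound `c ≤ s` makes the last term at least `‖f‖ + |ε|`; elsewhere it only
    -- needs to be nonnegative.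
    have hM : f ≤ ε • 1 + ((‖f‖ + |ε|) / c) • s := by
      intro z
      change f z ≤ ε * 1 + (‖f‖ + |ε|) / c * s z
      have hn : 0 ≤ (‖f‖ + |ε|) / c := by positivity
      by_cases hz : ε ≤ f z
      · have h1 : (‖f‖ + |ε|) / c * c ≤ (‖f‖ + |ε|) / c * s z :=
          mul_le_mul_of_nonneg_left (hcs z hz) hn
        rw [div_mul_cancel₀ _ hc.ne'] at h1
        have h2 := le_of_abs_le (f.norm_coe_le_norm z)
        have h3 := neg_abs_le ε
        linarith
      · have := mul_nonneg hn (hsnn z)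
        linarith [not_le.1 hz]
    have := state_mono hφ hM
    rwa [hφ.1, state_smul_one hφ, hφ.2.1, hs0, mul_zero, add_zero] at this

theorem stateSupport_nonempty [CompactSpace Y] : (stateSupport φ).Nonempty := by
  by_contra hne
  have := state_le_of_forall_support_lt hφ (f := 1) (ε := 1 / 2)
    fun y hy => (hne ⟨y, hy⟩).elim
  rw [hφ.2.2.2] at this
  norm_num at this

theorem state_abs_sub_le [CompactSpace Y] {f : C(Y, ℝ)} {a ε : ℝ}
    (h : ∀ y ∈ stateSupport φ, |f y - a| < ε) : |φ f - a| ≤ ε := by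
  have h1 := state_le_of_forall_support_lt hφ (f := f) (ε := a + ε) fun y hy => by
    linarith [(abs_lt.1 (h y hy)).2]
  have h2 := state_le_of_forall_support_lt hφ (f := (-1 : ℝ) • f) (ε := ε - a) fun y hy => by
    simp only [ContinuousMap.smul_apply, smul_eq_mul]
    linarith [(abs_lt.1 (h y hy)).1]
  rw [hφ.2.1] at h2
  exact abs_le.2 ⟨by linarith, by linarith⟩

theorem eq_evalState_of_support_subset [CompactSpace Y] {y : Y} (h : stateSupport φ ⊆ {y}) :
    φ = evalState y := by
  funext f
  refine eq_of_abs_sub_le_all fun ε hε => state_abs_sub_le hφ fun z hz => ?_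
  rw [h hz, evalState, sub_self, abs_zero]
  exact hε

end

theorem isClosed_stateSpace : IsClosed (stateSpace Y) := by
  simp only [stateSpace, Set.ofPred_and, Set.ofPred_forall]
  refine (isClosed_iInter fun f => isClosed_iInter fun g => isClosed_eq ?_ ?_).inter
    ((isClosed_iInter fun c => isClosed_iInter fun f => isClosed_eq ?_ ?_).inter
    ((isClosed_iInter fun f => isClosed_iInter fun _ => isClosed_le ?_ ?_).inter
    (isClosed_eq ?_ ?_))) <;> fun_prop

theorem isCompact_stateSpace [CompactSpace Y] : IsCompact (stateSpace Y) :=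
  (isCompact_univ_pi fun f : C(Y, ℝ) => isCompact_Icc (a := -‖f‖) (b := ‖f‖)).of_isClosed_subset
    isClosed_stateSpace fun _ hφ f _ => state_mem_Icc hφ f

theorem exists_nonneg_zero_one [CompactSpace Y] [T2Space Y] {s : Set Y} (hs : IsClosed s) {y : Y}
    (hy : y ∉ s) : ∃ f : C(Y, ℝ), 0 ≤ f ∧ (∀ z ∈ s, f z = 0) ∧ f y = 1 := by
  obtain ⟨f, h0, h1, h2⟩ := exists_continuous_zero_one_of_isClosed hs
    (isClosed_singleton (x := y)) (Set.disjoint_singleton_right.2 hy)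
  exact ⟨f, fun z => (h2 z).1, h0, h1 rfl⟩

/-- A state whose push-forward is a point mass is supported in a fibre. -/
theorem apply_eq_of_mem_stateSupport [CompactSpace Z] [T2Space Z] {φ : C(Y, ℝ) → ℝ} {u : C(Y, Z)}
    {z : Z} (h : pushState u φ = evalState z) {y : Y} (hy : y ∈ stateSupport φ) : u y = z := by
  by_contra hne
  obtain ⟨f, hf, h0, h1⟩ := exists_nonneg_zero_one (isClosed_singleton (x := z)) hne
  have := hy (f.comp u) (fun w => hf (u w)) ((congr_fun h f).trans (h0 z rfl))
  rw [ContinuousMap.comp_apply, h1] at this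
  norm_num at this

/-- The closure of a set of states contains a point mass as soon as the set contains states
supported in arbitrarily small neighbourhoods of the point. -/
theorem evalState_mem_closure [CompactSpace Y] {S : Set (C(Y, ℝ) → ℝ)} (hS : S ⊆ stateSpace Y)
    {y : Y} (h : ∀ V : Set Y, IsOpen V → y ∈ V → ∃ φ ∈ S, stateSupport φ ⊆ V) :
    evalState y ∈ closure S := by
  rw [mem_closure_iff]
  intro O hO hyO
  obtain ⟨F, v, hv, hsub⟩ := isOpen_pi_iff.1 hO _ hyO
  have : ∀ f ∈ F, ∃ ε > 0, Metric.ball (f y) ε ⊆ v f := fun f hf =>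
    Metric.isOpen_iff.1 (hv f hf).1 _ (hv f hf).2
  choose! ε hε hball using this
  -- Halving `ε f` leaves room for the non-strict estimate that the support bound gives.
  obtain ⟨φ, hφS, hφ⟩ := h (⋂ f ∈ F, {z | |f z - f y| < ε f / 2})
    (isOpen_biInter_finset fun f _ => isOpen_lt (by fun_prop) continuous_const)
    (Set.mem_iInter₂.2 fun f hf => by simpa using hε f hf)
  refine ⟨φ, hsub fun f hf => hball f hf ?_, hφS⟩
  have h1 : |φ f - f y| ≤ ε f / 2 := state_abs_sub_le (hS hφS) fun z hz =>
    Set.mem_iInter₂.1 (hφ hz) f hf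
  rw [Metric.mem_ball, Real.dist_eq]
  linarith [hε f hf]

/-- If the closure of the push-forward of a set of states contains a point mass, then some state
in the closure of the set has this push-forward. -/
theorem exists_mem_closure_pushState [CompactSpace Y] {S : Set (C(Y, ℝ) → ℝ)}
    (hS : S ⊆ stateSpace Y) (u : C(Y, Z)) {χ : C(Z, ℝ) → ℝ}
    (h : χ ∈ closure (pushState u '' S)) : ∃ ψ ∈ closure S, pushState u ψ = χ := by
  have hc : IsCompact (closure S) :=
    isCompact_stateSpace.of_isClosed_subset isClosed_closure
      (closure_minimal hS isClosed_stateSpace)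
  exact closure_minimal (Set.image_mono subset_closure)
    (hc.image (continuous_pushState u)).isClosed h

theorem isCompact_range_evalState [CompactSpace Y] :
    IsCompact (Set.range (evalState : Y → C(Y, ℝ) → ℝ)) :=
  isCompact_range continuous_evalState

end States

/-! ### Strong proximality in terms of states -/

section Proximal

variable {G : Type*} [Group G] {Y X : Type*} [TopologicalSpace Y] [TopologicalSpace X]
  [MulAction G Y] [ContinuousConstSMul G Y]

/-- Translation by `g`, as a continuous map. -/
def smulMap (Y : Type*) [TopologicalSpace Y] [MulAction G Y] [ContinuousConstSMul G Y] (g : G) :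
    C(Y, Y) :=
  ⟨(g • ·), continuous_const_smul g⟩

/-- The orbit of a functional under a set of translations. -/
def stateOrbit (K : Set G) (φ : C(Y, ℝ) → ℝ) : Set (C(Y, ℝ) → ℝ) :=
  (fun g => pushState (smulMap Y g) φ) '' K

/-- Every state over a point of `X` can be contracted to a point mass by elements of `K`. -/
def IsContracting (K : Set G) (π : C(Y, X)) : Prop :=
  ∀ φ ∈ stateSpace Y, ∀ x : X, pushState π φ = evalState x →
    ∃ y : Y, evalState y ∈ closure (stateOrbit K φ)

theorem pushState_smulMap_mul (g h : G) (φ : C(Y, ℝ) → ℝ) :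
    pushState (smulMap Y g) (pushState (smulMap Y h) φ) = pushState (smulMap Y (g * h)) φ := by
  rw [pushState_pushState]
  congr 1
  ext y
  exact smul_smul g h y

theorem pushState_smulMap_one (φ : C(Y, ℝ) → ℝ) : pushState (smulMap Y (1 : G)) φ = φ := by
  rw [show smulMap Y (1 : G) = ContinuousMap.id Y by ext y; exact one_smul G y, pushState_id]

theorem pushState_smulMap_evalState (g : G) (y : Y) :
    pushState (smulMap Y g) (evalState y) = evalState (g • y) := rfl

theorem stateOrbit_subset {K : Set G} {φ : C(Y, ℝ) → ℝ} (hφ : φ ∈ stateSpace Y) :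
    stateOrbit K φ ⊆ stateSpace Y := by
  rintro _ ⟨g, -, rfl⟩
  exact pushState_mem hφ _

theorem closure_stateOrbit_subset {K : Set G} {φ : C(Y, ℝ) → ℝ} (hφ : φ ∈ stateSpace Y) :
    closure (stateOrbit K φ) ⊆ stateSpace Y :=
  closure_minimal (stateOrbit_subset hφ) isClosed_stateSpace

theorem pushState_smulMap_mem_closure {K : Subgroup G} {φ ψ : C(Y, ℝ) → ℝ}
    (hψ : ψ ∈ closure (stateOrbit (K : Set G) φ)) {g : G} (hg : g ∈ K) :
    pushState (smulMap Y g) ψ ∈ closure (stateOrbit (K : Set G) φ) := by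
  refine map_mem_closure (continuous_pushState _) hψ ?_
  rintro _ ⟨h, hh, rfl⟩
  exact ⟨g * h, K.mul_mem hg hh, (pushState_smulMap_mul g h φ).symm⟩

theorem closure_stateOrbit_trans {K : Subgroup G} {L : Set G} (hL : L ⊆ K) {φ ψ : C(Y, ℝ) → ℝ}
    (hψ : ψ ∈ closure (stateOrbit (K : Set G) φ)) :
    closure (stateOrbit L ψ) ⊆ closure (stateOrbit (K : Set G) φ) := by
  refine closure_minimal ?_ isClosed_closure
  rintro _ ⟨g, hg, rfl⟩
  exact pushState_smulMap_mem_closure hψ (hL hg)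

/-- Contractibility passes to subgroups of finite index. -/
theorem IsContracting.of_finiteIndex {π : C(Y, X)} (h : IsContracting (Set.univ : Set G) π)
    (K : Subgroup G) [K.FiniteIndex] : IsContracting (K : Set G) π := by
  intro φ hφ x hx
  obtain ⟨y, hy⟩ := h φ hφ x hx
  have hfin : Finite (G ⧸ K) := inferInstance
  -- The full orbit is a finite union of translates of the `K`-orbit, so the point mass lies in the
  -- closure of one of them and can be translated back.
  have hsub : stateOrbit (Set.univ : Set G) φ ⊆
      ⋃ q : G ⧸ K, pushState (smulMap Y q.out) '' stateOrbit (K : Set G) φ := by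
    rintro _ ⟨g, -, rfl⟩
    obtain ⟨k, hk⟩ := QuotientGroup.mk_out_eq_mul K g
    refine Set.mem_iUnion.2 ⟨(g : G ⧸ K), _, ⟨(k⁻¹ : K), (k⁻¹).2, rfl⟩, ?_⟩
    rw [pushState_smulMap_mul, hk]
    simp
  have := closure_mono hsub hy
  rw [closure_iUnion_of_finite] at this
  obtain ⟨q, hq⟩ := Set.mem_iUnion.1 this
  refine ⟨q.out⁻¹ • y, ?_⟩
  have h2 : pushState (smulMap Y q.out⁻¹) (evalState y) ∈ closure (stateOrbit (K : Set G) φ) := by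
    refine map_mem_closure (continuous_pushState _) hq ?_
    rintro _ ⟨ψ, hψ, rfl⟩
    rwa [pushState_smulMap_mul, inv_mul_cancel, pushState_smulMap_one]
  exact h2

end Proximal

/-! ### States and regular Borel probability measures -/

section Riesz

variable {Y : Type*} [TopologicalSpace Y] [MeasurableSpace Y] [BorelSpace Y]

/-- States on a compact Hausdorff space are given by regular Borel probability measures. -/
theorem exists_probabilityMeasure_of_state [CompactSpace Y] [T2Space Y]
    {φ : C(Y, ℝ) → ℝ} (hφ : φ ∈ stateSpace Y) :
    ∃ ν : ProbabilityMeasure Y, (ν : Measure Y).Regular ∧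
      ∀ f : C(Y, ℝ), ∫ y, f y ∂(ν : Measure Y) = φ f := by
  let Λ : CompactlySupportedContinuousMap Y ℝ →ₚ[ℝ] ℝ :=
    { toFun := fun f => φ f
      map_add' := fun f g => hφ.1 f g
      map_smul' := fun c f => hφ.2.1 c f
      monotone' := fun f g h => state_mono hφ (f := (f : C(Y, ℝ))) (g := (g : C(Y, ℝ))) h }
  have hint : ∀ f : C(Y, ℝ), ∫ y, f y ∂(RealRMK.rieszMeasure Λ) = φ f := fun f =>
    RealRMK.integral_rieszMeasure Λ (CompactlySupportedContinuousMap.continuousMapEquiv f)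
  have hprob : IsProbabilityMeasure (RealRMK.rieszMeasure Λ) := by
    have := hint 1
    rw [hφ.2.2.2] at this
    simp only [ContinuousMap.one_apply, integral_const, smul_eq_mul, mul_one, measureReal_def]
      at this
    exact ⟨(ENNReal.toReal_eq_one_iff _).1 this⟩
  exact ⟨⟨RealRMK.rieszMeasure Λ, hprob⟩, inferInstanceAs (RealRMK.rieszMeasure Λ).Regular, hint⟩

/-- The state given by integration. -/
noncomputable def integralState (ν : ProbabilityMeasure Y) : C(Y, ℝ) → ℝ :=
  fun f => ∫ y, f y ∂(ν : Measure Y)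

theorem integrable_continuousMap [CompactSpace Y] (ν : ProbabilityMeasure Y) (f : C(Y, ℝ)) :
    Integrable f (ν : Measure Y) :=
  f.continuous.integrable_of_hasCompactSupport (HasCompactSupport.of_compactSpace f)

theorem integralState_mem [CompactSpace Y] (ν : ProbabilityMeasure Y) :
    integralState ν ∈ stateSpace Y := by
  refine ⟨fun f g => integral_add (integrable_continuousMap ν f) (integrable_continuousMap ν g),
    fun c f => integral_const_mul c _, fun f hf => integral_nonneg hf, ?_⟩
  simp [integralState]

/-- On a compact space the bounded continuous test functions are all of `C(Y, ℝ)`. Injectivity is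
not claimed, as measures need not be regular; inducing is enough to transport closures. -/
theorem isInducing_integralState [CompactSpace Y] :
    Topology.IsInducing (integralState : ProbabilityMeasure Y → C(Y, ℝ) → ℝ) := by
  refine Topology.isInducing_iff_nhds.2 fun ν => le_antisymm ?_ ?_
  · rw [← Filter.tendsto_iff_comap, tendsto_pi_nhds]
    intro f
    exact (ProbabilityMeasure.tendsto_iff_forall_integral_tendsto.1 Filter.tendsto_id)
      (BoundedContinuousFunction.mkOfCompact f)
  · refine Filter.tendsto_id'.1 (ProbabilityMeasure.tendsto_iff_forall_integral_tendsto.2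
      fun f => ?_)
    exact ((continuous_apply f.toContinuousMap).tendsto (integralState ν)).comp
      Filter.tendsto_comap

theorem integralState_diracProba [T2Space Y] (y : Y) :
    integralState (diracProba y) = evalState y := by
  funext f
  simp [integralState, evalState, diracProba]

theorem integralState_map {G : Type*} [Group G] [MulAction G Y] [ContinuousConstSMul G Y]
    (ν : ProbabilityMeasure Y) (g : G) :
    integralState (ν.map (measurable_const_smul g).aemeasurable) =
      pushState (smulMap Y g) (integralState ν) := by
  funext f
  simp only [integralState, pushState, ProbabilityMeasure.toMeasure_map]
  exact integral_map (measurable_const_smul g).aemeasurable f.continuous.aestronglyMeasurable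

end Riesz

/-! ### Strong proximality for measures versus contraction of states -/

section Bridge

variable {G : Type u} [Group G] {Y X : Type u} [TopologicalSpace Y] [TopologicalSpace X]
  [CompactSpace Y] [T2Space Y] [CompactSpace X] [T2Space X]
  [MulAction G Y] [ContinuousConstSMul G Y]

theorem diracProba_mem_closure_iff [MeasurableSpace Y] [BorelSpace Y] (ν : ProbabilityMeasure Y)
    (y : Y) : diracProba y ∈
        closure (Set.range fun g : G => ν.map (measurable_const_smul g).aemeasurable) ↔
      evalState y ∈ closure (stateOrbit (Set.univ : Set G) (integralState ν)) := by
  rw [isInducing_integralState.closure_eq_preimage_closure_image, Set.mem_preimage,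
    integralState_diracProba, ← Set.range_comp, stateOrbit, Set.image_univ]
  simp only [Function.comp_def, integralState_map]

theorem IsStronglyProximal.isContracting {π : C(Y, X)} (h : IsStronglyProximal G π) :
    IsContracting (Set.univ : Set G) π := by
  intro φ hφ x hx
  let _ : MeasurableSpace Y := borel Y
  have _ : BorelSpace Y := ⟨rfl⟩
  obtain ⟨ν, hreg, hν⟩ := exists_probabilityMeasure_of_state hφ
  have hνφ : integralState ν = φ := funext hν
  have hsupp : (ν : Measure Y).support ⊆ π ⁻¹' {x} := by
    intro y hy
    by_contra hne
    obtain ⟨f, hf, h0, h1⟩ := exists_nonneg_zero_one (isClosed_singleton (x := x)) hne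
    have hz : ∫ y, f (π y) ∂(ν : Measure Y) = 0 :=
      ((hν (f.comp π)).trans (congr_fun hx f)).trans (h0 x rfl)
    have hae := (integral_eq_zero_iff_of_nonneg (fun y => hf (π y))
      (integrable_continuousMap ν (f.comp π))).1 hz
    have hpos := (Measure.mem_support_iff_forall y).1 hy {z | f (π z) ≠ 0}
      ((isOpen_ne_fun (by fun_prop) continuous_const).mem_nhds
        (by rw [Set.mem_ofPred_eq, h1]; exact one_ne_zero))
    exact hpos.ne' hae
  obtain ⟨y, hy⟩ := h ν hreg x hsupp
  exact ⟨y, hνφ ▸ (diracProba_mem_closure_iff ν y).1 hy⟩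

-- Regularity makes the support conull, so functions pulled back from `X` are almost everywhere
-- constant.
omit [CompactSpace X] [T2Space X] in
theorem IsContracting.isStronglyProximal {π : C(Y, X)}
    (h : IsContracting (Set.univ : Set G) π) : IsStronglyProximal G π := by
  intro ν hreg x hx
  let _ : MeasurableSpace Y := borel Y
  have _ : BorelSpace Y := ⟨rfl⟩
  have hstate : pushState π (integralState ν) = evalState x := by
    funext f
    have hae : ∀ᵐ y ∂(ν : Measure Y), f (π y) = f x := by
      filter_upwards [Measure.support_mem_ae_of_regular (μ := (ν : Measure Y))] with y hy
      rw [show π y = x from hx hy]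
    simp only [pushState, integralState, ContinuousMap.comp_apply, evalState]
    rw [integral_congr_ae hae]
    simp
  obtain ⟨y, hy⟩ := h _ (integralState_mem ν) x hstate
  exact ⟨y, (diracProba_mem_closure_iff ν y).2 hy⟩

end Bridge

/-! ### Minimal sets -/

section Minimal

instance Subgroup.instContinuousConstSMul {G Y : Type*} [Group G] [TopologicalSpace Y]
    [MulAction G Y] [ContinuousConstSMul G Y] (N : Subgroup G) : ContinuousConstSMul N Y :=
  ⟨fun n => continuous_const_smul (n : G)⟩

variable {G : Type*} [Group G] {Y : Type*} [TopologicalSpace Y] [MulAction G Y]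
  [ContinuousConstSMul G Y]

omit [ContinuousConstSMul G Y] in
theorem closure_orbit_subset {C : Set Y} (hC : IsClosed C) (hinv : ∀ g : G, ∀ y ∈ C, g • y ∈ C)
    {y : Y} (hy : y ∈ C) : closure (MulAction.orbit G y) ⊆ C :=
  closure_minimal (by rintro _ ⟨g, rfl⟩; exact hinv g y hy) hC

theorem smul_mem_closure_orbit {y z : Y} (g : G) (hz : z ∈ closure (MulAction.orbit G y)) :
    g • z ∈ closure (MulAction.orbit G y) :=
  smul_closure_orbit_subset g y (Set.smul_mem_smul_set hz)

theorem closure_orbit_trans {y z : Y} (hz : z ∈ closure (MulAction.orbit G y)) :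
    closure (MulAction.orbit G z) ⊆ closure (MulAction.orbit G y) :=
  closure_orbit_subset isClosed_closure (fun g _ h => smul_mem_closure_orbit g h) hz

variable (G Y) in
/-- Every compact `G`-space contains a minimal set. -/
theorem exists_minimal_invariant [CompactSpace Y] [Nonempty Y] :
    ∃ M : Set Y, IsClosed M ∧ M.Nonempty ∧ (∀ g : G, ∀ y ∈ M, g • y ∈ M) ∧
      ∀ y ∈ M, M ⊆ closure (MulAction.orbit G y) := by
  obtain ⟨M, hM⟩ := zorn_superset
    {C : Set Y | IsClosed C ∧ C.Nonempty ∧ ∀ g : G, ∀ y ∈ C, g • y ∈ C} (by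
      intro c hc hchain
      rcases c.eq_empty_or_nonempty with rfl | hne
      · exact ⟨Set.univ, ⟨isClosed_univ, Set.univ_nonempty, fun _ _ _ => trivial⟩,
          fun s hs => absurd hs (Set.notMem_empty s)⟩
      · refine ⟨⋂₀ c, ⟨isClosed_sInter fun s hs => (hc hs).1, ?_, fun g y hy s hs =>
          (hc hs).2.2 g y (hy s hs)⟩, fun s hs => Set.sInter_subset_of_mem hs⟩
        have : Nonempty c := hne.to_subtype
        exact IsCompact.nonempty_sInter_of_directed_nonempty_isCompact_isClosed
          (fun a ha b hb => (hchain.total ha hb).elim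
            (fun h => ⟨a, ha, subset_rfl, h⟩) fun h => ⟨b, hb, h, subset_rfl⟩)
          (fun s hs => (hc hs).2.1) (fun s hs => (hc hs).1.isCompact)
          (fun s hs => (hc hs).1))
  refine ⟨M, hM.prop.1, hM.prop.2.1, hM.prop.2.2, fun y hy => ?_⟩
  exact hM.le_of_le ⟨isClosed_closure, (MulAction.nonempty_orbit y).closure,
    fun g z hz => smul_mem_closure_orbit g hz⟩ (closure_orbit_subset hM.prop.1 hM.prop.2.2 hy)

variable (N : Subgroup G) [N.Normal]

theorem smul_mem_closure_orbit_smul {y z : Y} (t : G) (hz : z ∈ closure (MulAction.orbit N y)) :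
    t • z ∈ closure (MulAction.orbit N (t • y)) := by
  refine map_mem_closure (continuous_const_smul t) hz ?_
  rintro _ ⟨n, rfl⟩
  refine ⟨⟨t * n * t⁻¹, ‹N.Normal›.conj_mem n n.2 t⟩, ?_⟩
  simp [Subgroup.smul_def, mul_smul]

variable [N.FiniteIndex] [MulAction.IsMinimal G Y]

-- By normality a `G`-orbit splits into finitely many `N`-orbits, one for each coset, and closure
-- commutes with finite unions.
omit [ContinuousConstSMul G Y] in
theorem exists_mem_closure_orbit_out_smul (y₀ y : Y) :
    ∃ q : G ⧸ N, y ∈ closure (MulAction.orbit N (q.out • y₀)) := by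
  have h := MulAction.dense_orbit G y₀ y
  have hsub : MulAction.orbit G y₀ ⊆ ⋃ q : G ⧸ N, MulAction.orbit N (q.out • y₀) := by
    rintro _ ⟨g, rfl⟩
    obtain ⟨n, hn⟩ := QuotientGroup.mk_out_eq_mul N g
    refine Set.mem_iUnion.2 ⟨(g : G ⧸ N), ⟨g * (n : G)⁻¹ * g⁻¹,
      ‹N.Normal›.conj_mem _ (N.inv_mem n.2) g⟩, ?_⟩
    simp [hn, Subgroup.smul_def, ← mul_smul]
  have := closure_mono hsub h
  rw [closure_iUnion_of_finite] at this
  exact Set.mem_iUnion.1 this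

variable [CompactSpace Y]

/-- In a minimal system, the orbit closures of a normal subgroup of finite index are minimal. -/
theorem mem_closure_orbit_symm {y z : Y} (hz : z ∈ closure (MulAction.orbit N y)) :
    y ∈ closure (MulAction.orbit N z) := by
  have : Nonempty Y := ⟨y⟩
  obtain ⟨M, hMc, ⟨y₀, hy₀⟩, hMi, hM⟩ := exists_minimal_invariant N Y
  obtain ⟨q, hq⟩ := exists_mem_closure_orbit_out_smul N y₀ y
  set t := q.out
  -- Translation by `t⁻¹` carries the orbit closure containing `y` and `z` into the minimal set `M`,
  -- where symmetry is clear.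
  have key : ∀ w, w ∈ closure (MulAction.orbit N (t • y₀)) → t⁻¹ • w ∈ M := fun w hw => by
    have := smul_mem_closure_orbit_smul N t⁻¹ hw
    rw [inv_smul_smul] at this
    exact closure_orbit_subset hMc hMi hy₀ this
  have h := smul_mem_closure_orbit_smul N t (hM _ (key z (closure_orbit_trans hq hz)) (key y hq))
  rwa [smul_inv_smul, smul_inv_smul] at h

/-- A connected minimal system is minimal for normal subgroups of finite index. -/
theorem isMinimal_of_preconnectedSpace [PreconnectedSpace Y] : MulAction.IsMinimal N Y := by
  refine ⟨fun y => ?_⟩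
  -- Symmetry makes the orbit closures a finite partition into closed sets, so each is clopen.
  have hcompl : (closure (MulAction.orbit N y))ᶜ =
      ⋃ q ∈ {q : G ⧸ N | y ∉ closure (MulAction.orbit N (q.out • y))},
        closure (MulAction.orbit N (q.out • y)) := by
    ext z
    simp only [Set.mem_compl_iff, Set.mem_iUnion, Set.mem_ofPred_eq, exists_prop]
    constructor
    · intro hz
      obtain ⟨q, hq⟩ := exists_mem_closure_orbit_out_smul N y z
      exact ⟨q, fun hy => hz (closure_orbit_trans (mem_closure_orbit_symm N hy) hq), hq⟩
    · rintro ⟨q, hy, hq⟩ hz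
      exact hy (closure_orbit_trans hq (mem_closure_orbit_symm N hz))
  have hopen : IsOpen (closure (MulAction.orbit N y)) := by
    rw [← isClosed_compl_iff, hcompl]
    exact (Set.toFinite _).isClosed_biUnion fun _ _ => isClosed_closure
  exact dense_iff_closure_eq.2 (IsClopen.eq_univ ⟨isClosed_closure, hopen⟩
    (MulAction.nonempty_orbit y).closure)

end Minimal

/-! ### Uniqueness and existence of equivariant maps -/

section Maps

/-- Two maps out of a minimal space which intertwine the action of a subgroup of finite index with
a contracting family of maps, and lie over the same map to the base, are equal. -/
theorem eq_of_contracting {G : Type*} [Group G] {B W X : Type*} [TopologicalSpace B]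
    [CompactSpace B] [MulAction G B] [ContinuousConstSMul G B] [MulAction.IsMinimal G B]
    [TopologicalSpace W] [CompactSpace W] [T2Space W] [TopologicalSpace X]
    (N : Subgroup G) [N.Normal] [N.FiniteIndex] (p : C(W, X)) (a : N → C(W, W))
    (hcontr : ∀ θ ∈ stateSpace W, ∀ x, pushState p θ = evalState x →
      ∃ w, evalState w ∈ closure (Set.range fun n => pushState (a n) θ))
    {φ ψ : B → W} (hφ : Continuous φ) (hψ : Continuous ψ)
    (hφN : ∀ (n : N) b, φ (n • b) = a n (φ b)) (hψN : ∀ (n : N) b, ψ (n • b) = a n (ψ b))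
    (hp : ∀ b, p (φ b) = p (ψ b)) : φ = ψ := by
  funext b
  -- The average of the point masses at `φ b` and `ψ b`.
  let Θ : B → C(W, ℝ) → ℝ := fun b f => (f (φ b) + f (ψ b)) / 2
  have hΘ : Continuous Θ := continuous_pi fun f => by fun_prop
  have hstate : Θ b ∈ stateSpace W := by
    refine ⟨fun f g => ?_, fun c f => ?_, fun f hf => ?_, ?_⟩
    · simp only [Θ, ContinuousMap.add_apply]; ring
    · simp only [Θ, ContinuousMap.smul_apply, smul_eq_mul]; ring
    · exact div_nonneg (add_nonneg (hf _) (hf _)) zero_le_two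
    · simp only [Θ, ContinuousMap.one_apply]; norm_num
  obtain ⟨w, hw⟩ := hcontr (Θ b) hstate (p (φ b)) (by
    funext f
    simp only [pushState, Θ, ContinuousMap.comp_apply, ← hp, evalState]
    ring)
  have himg : evalState w ∈ Θ '' closure (MulAction.orbit N b) := by
    refine closure_minimal ?_ (isClosed_closure.isCompact.image hΘ).isClosed hw
    rintro _ ⟨n, rfl⟩
    refine ⟨n • b, subset_closure ⟨n, rfl⟩, ?_⟩
    funext f
    simp only [Θ, hφN, hψN]
    rfl
  obtain ⟨b', hb', hΘw⟩ := himg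
  have haux : ∀ f : C(W, ℝ), (f (φ b') + f (ψ b')) / 2 = f w := congr_fun hΘw
  -- A point mass is extreme: a function vanishing at `w` and equal to 1 at the other point would
  -- have positive average.
  have heq : φ b' = ψ b' := by
    have h1 : φ b' = w := by
      by_contra hne
      obtain ⟨f, hf, h0, h1⟩ := exists_nonneg_zero_one (isClosed_singleton (x := w)) hne
      have := haux f
      rw [h0 w rfl, h1] at this
      linarith [show 0 ≤ f (ψ b') from hf _]
    have h2 : ψ b' = w := by
      by_contra hne
      obtain ⟨f, hf, h0, h1⟩ := exists_nonneg_zero_one (isClosed_singleton (x := w)) hne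
      have := haux f
      rw [h0 w rfl, h1] at this
      linarith [show 0 ≤ f (φ b') from hf _]
    rw [h1, h2]
  refine closure_orbit_subset (G := N) (C := {z | φ z = ψ z}) (isClosed_eq hφ hψ)
    (fun n z hz => ?_) heq (mem_closure_orbit_symm N hb')
  rw [Set.mem_ofPred_eq, hφN, hψN, hz]

/-- The generalized Furstenberg boundary maps equivariantly to every nonempty compact space over
the base which is contracting. -/
theorem IsGenFurstenbergBoundary.exists_map {G : Type u} [Group G] {B X W : Type u}
    [TopologicalSpace B] [TopologicalSpace X] [CompactSpace X] [T2Space X] [MulAction G B]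
    [ContinuousConstSMul G B] [MulAction G X] [ContinuousConstSMul G X]
    [MulAction.IsMinimal G X] {π : B → X}
    (hπ : IsGenFurstenbergBoundary G π) [TopologicalSpace W] [CompactSpace W] [T2Space W]
    [Nonempty W] [MulAction G W] [ContinuousConstSMul G W] (p : C(W, X))
    (hp : ∀ (g : G) w, p (g • w) = g • p w) (hc : IsContracting (Set.univ : Set G) p) :
    ∃ σ : B → W, Continuous σ ∧ (∀ (g : G) b, σ (g • b) = g • σ b) ∧ ∀ b, p (σ b) = π b := by
  obtain ⟨M, hMc, ⟨w₀, hw₀⟩, hMi, hM⟩ := exists_minimal_invariant G W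
  let S : SubMulAction G W := ⟨M, fun g _ hw => hMi g _ hw⟩
  have : CompactSpace S := isCompact_iff_compactSpace.1 hMc.isCompact
  have : ContinuousConstSMul G S := ⟨fun g =>
    Continuous.subtype_mk ((continuous_const_smul g).comp continuous_subtype_val) _⟩
  have hmin : MulAction.IsMinimal G S := by
    refine ⟨fun s => fun t => ?_⟩
    rw [closure_subtype]
    convert hM s s.2 t.2
    ext w
    constructor
    · rintro ⟨_, ⟨g, rfl⟩, rfl⟩
      exact ⟨g, rfl⟩
    · rintro ⟨g, rfl⟩
      exact ⟨g • s, ⟨g, rfl⟩, rfl⟩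
  let i : C(S, W) := ⟨Subtype.val, continuous_subtype_val⟩
  have hsurj : Set.range (p.comp i) = Set.univ := by
    refine (eq_empty_or_univ_of_smul_invariant_closed G
      (isCompact_range (map_continuous _)).isClosed ?_).resolve_left (Set.Nonempty.ne_empty ⟨_, ⟨w₀, hw₀⟩, rfl⟩)
    rintro g _ ⟨_, ⟨s, rfl⟩, rfl⟩
    exact ⟨g • s, hp g s⟩
  -- Contract in `W`, lift the limit to a state on `S` by compactness, and note that injectivity of
  -- `i` leaves it a single support point.
  have hcontr : IsContracting (Set.univ : Set G) (p.comp i) := by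
    intro φ hφ x hx
    obtain ⟨w, hw⟩ := hc (pushState i φ) (pushState_mem hφ i) x hx
    have hO : stateOrbit (Set.univ : Set G) (pushState i φ) =
        pushState i '' stateOrbit (Set.univ : Set G) φ := by
      simp only [stateOrbit, Set.image_image]
      rfl
    rw [hO] at hw
    obtain ⟨ψ, hψ, hψw⟩ := exists_mem_closure_pushState (stateOrbit_subset hφ) i hw
    have hψs := closure_stateOrbit_subset hφ hψ
    obtain ⟨s, hs⟩ := stateSupport_nonempty hψs
    refine ⟨s, ?_⟩
    rwa [← eq_evalState_of_support_subset hψs (y := s) fun t ht => Subtype.ext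
      ((apply_eq_of_mem_stateSupport hψw ht).trans (apply_eq_of_mem_stateSupport hψw hs).symm)]
  obtain ⟨Φ, ⟨hΦ, hΦp⟩, -⟩ := hπ.universal S (p.comp i)
    ⟨⟨map_continuous _, Set.range_eq_univ.1 hsurj, fun g s => hp g s⟩, hmin,
      hcontr.isStronglyProximal⟩
  exact ⟨fun b => Φ b, continuous_subtype_val.comp hΦ.continuous,
    fun g b => congr_arg Subtype.val (hΦ.map_smul g b), fun b => congr_fun hΦp b⟩

end Maps

/-! ### Commensurated subgroups -/

section Commensurated

variable {Γ : Type u} [Group Γ] {H : Subgroup Γ}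

theorem mem_conjInter {g k : Γ} : k ∈ conjInter H g ↔ k ∈ H ∧ g * k * g⁻¹ ∈ H := by
  rw [conjInter, Subgroup.mem_inf, Subgroup.mem_pointwise_smul_iff_inv_smul_mem]
  simp

theorem IsCommensurated.finiteIndex_conjInter (hH : IsCommensurated H) (g : Γ) :
    ((conjInter H g).subgroupOf H).FiniteIndex :=
  ⟨hH g⁻¹⟩

/-- `gNg⁻¹` has finite index in `gHg⁻¹`, whose intersection with `H` has finite index in `H`. -/
theorem IsCommensurated.finiteIndex_conj (hH : IsCommensurated H) (g : Γ) (N : Subgroup H)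
    [N.FiniteIndex] : ((MulAut.conj g • N.map H.subtype).subgroupOf H).FiniteIndex := by
  refine ⟨?_⟩
  change (MulAut.conj g • N.map H.subtype).relIndex H ≠ 0
  refine Subgroup.relIndex_ne_zero_trans (K := MulAut.conj g • H) ?_ ?_
  · rw [Subgroup.relIndex_pointwise_smul, Subgroup.relIndex, Subgroup.subgroupOf,
      Subgroup.comap_map_eq_self_of_injective H.subtype_injective]
    exact Subgroup.FiniteIndex.index_ne_zero
  · have := hH g
    rwa [Subgroup.inf_relIndex_left] at this

end Commensurated

/-! ### Contraction and rigidity through conjugation -/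

section Twisted

variable {Γ X B : Type u} [Group Γ] {H : Subgroup Γ}
  [TopologicalSpace X] [TopologicalSpace B] [MulAction H B] [ContinuousConstSMul H B]

/-- Contractibility by a subgroup of finite index, acting through conjugation by `g`. -/
theorem IsContracting.exists_conj (hH : IsCommensurated H) {π : C(B, X)}
    (hc : IsContracting (Set.univ : Set H) π) (g : Γ) (N : Subgroup H) [N.FiniteIndex]
    (hN : ∀ n : N, g * (n : H) * g⁻¹ ∈ H) {θ : C(B, ℝ) → ℝ} (hθ : θ ∈ stateSpace B) {x : X}
    (hx : pushState π θ = evalState x) :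
    ∃ w, evalState w ∈
      closure (Set.range fun n : N => pushState (smulMap B (⟨_, hN n⟩ : H)) θ) := by
  have := hH.finiteIndex_conj g N
  obtain ⟨w, hw⟩ := hc.of_finiteIndex ((MulAut.conj g • N.map H.subtype).subgroupOf H) θ hθ x hx
  refine ⟨w, closure_mono ?_ hw⟩
  rintro _ ⟨k, hk, rfl⟩
  rw [SetLike.mem_coe, Subgroup.mem_subgroupOf,
    Subgroup.mem_pointwise_smul_iff_inv_smul_mem] at hk
  obtain ⟨n, hn, hnk⟩ := hk
  refine ⟨⟨n, hn⟩, ?_⟩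
  have : (⟨_, hN ⟨n, hn⟩⟩ : H) = k := Subtype.ext (by
    have hnk' : (n : Γ) = g⁻¹ * k * g := by simpa using hnk
    simp only [hnk']
    group)
  simp only [this]

/-- Maps of the boundary which intertwine a subgroup of finite index with its conjugate and lie
over the same map of the base are equal. -/
theorem eq_of_conj_equivariant [CompactSpace B] [T2Space B] (hH : IsCommensurated H)
    [MulAction.IsMinimal H B] {π : C(B, X)} (hc : IsContracting (Set.univ : Set H) π) (g : Γ)
    (N : Subgroup H) [N.FiniteIndex] (hN : ∀ n ∈ N, g * n * g⁻¹ ∈ H) {φ ψ : B → B}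
    (hφ : Continuous φ) (hψ : Continuous ψ)
    (hφN : ∀ (n : H) (hn : n ∈ N) b, φ (n • b) = (⟨_, hN n hn⟩ : H) • φ b)
    (hψN : ∀ (n : H) (hn : n ∈ N) b, ψ (n • b) = (⟨_, hN n hn⟩ : H) • ψ b)
    (hp : ∀ b, π (φ b) = π (ψ b)) : φ = ψ := by
  have hN' : ∀ n : N.normalCore, g * (n : H) * g⁻¹ ∈ H := fun n => hN n (N.normalCore_le n.2)
  refine eq_of_contracting N.normalCore π (fun n => smulMap B (⟨_, hN' n⟩ : H))
    (fun θ hθ x hx => hc.exists_conj hH g N.normalCore hN' hθ hx) hφ hψ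
    (fun n b => hφN n (N.normalCore_le n.2) b) (fun n b => hψN n (N.normalCore_le n.2) b) hp

end Twisted

/-- Translates of a state over a point lie over points, and the point masses on compact `X` form a
closed set. -/
theorem exists_pushState_eq_evalState {G Y X : Type*} [Group G] [TopologicalSpace Y]
    [TopologicalSpace X] [CompactSpace X] [MulAction G Y] [ContinuousConstSMul G Y] [MulAction G X]
    [ContinuousConstSMul G X] {p : C(Y, X)} (hp : ∀ (g : G) y, p (g • y) = g • p y)
    {K : Set G} {φ ψ : C(Y, ℝ) → ℝ} {x : X} (hx : pushState p φ = evalState x) (hψ : ψ ∈ closure (stateOrbit K φ)) :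
    ∃ x' : X, pushState p ψ = evalState x' := by
  have h : pushState p ψ ∈ closure (Set.range (evalState : X → C(X, ℝ) → ℝ)) := by
    refine map_mem_closure (continuous_pushState p) hψ ?_
    rintro _ ⟨g, -, rfl⟩
    refine ⟨g • x, ?_⟩
    rw [pushState_pushState, ← pushState_smulMap_evalState, ← hx, pushState_pushState]
    congr 1
    ext y
    exact (hp g y).symm
  rw [isCompact_range_evalState.isClosed.closure_eq] at h
  exact h.imp fun _ => Eq.symm

/-! ### The coinduced space -/

section Coinduction

variable {Γ X B : Type u} [Group Γ] (H : Subgroup Γ) [MulAction Γ X] [MulAction H B]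

/-- The space of `H`-equivariant maps `Γ → B` which lie over an orbit map of `X`. -/
abbrev Coinduced (π : B → X) : Type u :=
  {f : Γ → B // (∀ (h : H) γ, f (h * γ) = h • f γ) ∧ ∀ γ, π (f γ) = γ • π (f 1)}

namespace Coinduced

variable {H} {π : B → X}

instance : MulAction H (Coinduced H π) where
  smul h f := ⟨fun γ => f.1 (γ * h), fun k γ => by
    change f.1 (k * γ * h) = k • f.1 (γ * h)
    rw [mul_assoc, f.2.1], fun γ => by
    change π (f.1 (γ * h)) = γ • π (f.1 (1 * h))
    rw [f.2.2, f.2.2 (1 * h), one_mul, mul_smul]⟩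
  one_smul f := Subtype.ext (funext fun γ => congr_arg f.1 (mul_one γ))
  mul_smul h k f := Subtype.ext (funext fun γ => congr_arg f.1 (mul_assoc γ h k).symm)

theorem smul_val (h : H) (f : Coinduced H π) (γ : Γ) : (h • f).1 γ = f.1 (γ * h) := rfl

/-- On the coordinate `γ`, the finite-index subgroup `H ∩ γ⁻¹Hγ` acts pointwise through conjugation,
so coordinates can be contracted one at a time. -/
theorem smul_val_eq_conj_smul (h : H) (f : Coinduced H π) {γ : Γ} (hγ : γ * h * γ⁻¹ ∈ H) :
    (h • f).1 γ = (⟨_, hγ⟩ : H) • f.1 γ := by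
  rw [smul_val, ← f.2.1]
  simp

theorem val_smul (h : H) (f : Coinduced H π) : f.1 h = h • f.1 1 := by
  rw [← f.2.1, mul_one]

theorem nonempty [Nonempty B] (hsurj : Function.Surjective π)
    (hπ : ∀ (h : H) b, π (h • b) = h • π b) : Nonempty (Coinduced H π) := by
  let x : X := π (Classical.arbitrary B)
  -- A representative of each coset `Hγ`; a lift of `r γ • x` is chosen there and spread along the
  -- coset equivariantly.
  let r : Γ → Γ := fun γ => (Quotient.mk (QuotientGroup.rightRel H) γ).out
  have hr : ∀ γ, γ * (r γ)⁻¹ ∈ H := fun γ =>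
    QuotientGroup.rightRel_apply.1 (Quotient.mk_out (s := QuotientGroup.rightRel H) γ)
  have hrH : ∀ (h : H) γ, r (h * γ) = r γ := fun h γ =>
    congr_arg Quotient.out (Quotient.sound (QuotientGroup.rightRel_apply.2 (by simp)))
  have hval : ∀ γ, π ((⟨_, hr γ⟩ : H) • Function.surjInv hsurj (r γ • x)) = γ • x := fun γ => by
    rw [hπ, Function.surjInv_eq hsurj, Subgroup.smul_def, smul_smul, inv_mul_cancel_right]
  refine ⟨⟨fun γ => (⟨_, hr γ⟩ : H) • Function.surjInv hsurj (r γ • x), fun h γ => ?_, fun γ => ?_⟩⟩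
  · simp only [smul_smul, hrH]
    congr 1
    exact Subtype.ext (mul_assoc _ _ _)
  · rw [hval, hval, one_smul]

variable [TopologicalSpace X] [TopologicalSpace B]

theorem compactSpace [CompactSpace B] [T2Space B] [T2Space X] [ContinuousConstSMul H B]
    [ContinuousConstSMul Γ X] (hπ : Continuous π) : CompactSpace (Coinduced H π) := by
  have h : IsClosed {f : Γ → B | (∀ (h : H) γ, f (h * γ) = h • f γ) ∧
      ∀ γ, π (f γ) = γ • π (f 1)} := by
    rw [Set.ofPred_and]
    simp only [Set.ofPred_forall]
    refine (isClosed_iInter fun h => isClosed_iInter fun γ => isClosed_eq ?_ ?_).inter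
      (isClosed_iInter fun γ => isClosed_eq ?_ ?_) <;> fun_prop
  exact isCompact_iff_compactSpace.1 h.isCompact

/-- Evaluation at an element of the group. -/
def eval (γ : Γ) : C(Coinduced H π, B) :=
  ⟨fun f => f.1 γ, (continuous_apply γ).comp continuous_subtype_val⟩

instance [ContinuousConstSMul H B] : ContinuousConstSMul H (Coinduced H π) :=
  ⟨fun h => continuous_induced_rng.2 (continuous_pi fun γ => (eval (γ * h)).continuous)⟩

/-- The coinduced space of a contracting space is contracting. -/
theorem isContracting [CompactSpace X] [T2Space X] [CompactSpace B] [T2Space B]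
    [ContinuousConstSMul H B] [ContinuousConstSMul Γ X] (hH : IsCommensurated H) {π : C(B, X)}
    (hc : IsContracting (Set.univ : Set H) π) :
    IsContracting (Set.univ : Set H) (π.comp (eval 1 : C(Coinduced H π, B))) := by
  have := compactSpace (H := H) π.continuous
  set p : C(Coinduced H π, X) := π.comp (eval 1) with hpdef
  have hp : ∀ (h : H) (f : Coinduced H π), p (h • f) = h • p f := fun h f => by
    change π (f.1 (1 * h)) = (h : Γ) • π (f.1 1)
    rw [one_mul, f.2.2]
  intro φ hφ x hx
  rw [← Subgroup.coe_top]
  set C := closure (stateOrbit ((⊤ : Subgroup H) : Set H) φ) with hC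
  have hCs : C ⊆ stateSpace _ := closure_stateOrbit_subset hφ
  let D : Γ → Set (C(Coinduced H π, ℝ) → ℝ) := fun γ =>
    pushState (eval γ) ⁻¹' Set.range evalState
  have hD : ∀ γ, IsClosed (D γ) := fun γ =>
    isCompact_range_evalState.isClosed.preimage (continuous_pushState _)
  -- Induction on coordinates: `N` acts on each coordinate in `F` through `H`, so contracting a new
  -- coordinate by `N` keeps the earlier ones point masses.
  have hfin : ∀ F : Finset Γ, ∃ N : Subgroup H, N.FiniteIndex ∧
      (∀ γ ∈ F, ∀ n ∈ N, γ * n * γ⁻¹ ∈ H) ∧ ∃ ψ ∈ C, ∀ γ ∈ F, ψ ∈ D γ := by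
    classical
    intro F
    induction F using Finset.induction_on with
    | empty =>
      exact ⟨⊤, inferInstance, fun _ h => absurd h (Finset.notMem_empty _), φ,
        subset_closure ⟨1, trivial, pushState_smulMap_one φ⟩,
        fun _ h => absurd h (Finset.notMem_empty _)⟩
    | insert γ F _ ih =>
      obtain ⟨N₀, hN₀, hconj, ψ, hψ, hψD⟩ := ih
      have := hH.finiteIndex_conjInter γ
      set N := N₀ ⊓ (conjInter H γ).subgroupOf H with hNdef
      have hNγ : ∀ n : N, γ * (n : H) * γ⁻¹ ∈ H := fun n => (mem_conjInter.1 n.2.2).2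
      obtain ⟨x', hx'⟩ := exists_pushState_eq_evalState hp hx hψ
      have hψγ : pushState π (pushState (eval γ) ψ) = evalState (γ • x') := by
        rw [← pushState_smulMap_evalState, ← hx', pushState_pushState,
          pushState_pushState]
        congr 1
        ext f
        exact f.2.2 γ
      obtain ⟨w, hw⟩ := hc.exists_conj hH γ N hNγ (pushState_mem (hCs hψ) (eval γ)) hψγ
      have himg : (Set.range fun n : N =>
          pushState (smulMap B (⟨_, hNγ n⟩ : H)) (pushState (eval γ) ψ)) =
          pushState (eval γ) '' stateOrbit (N : Set H) ψ := by
        rw [stateOrbit, Set.image_image, Set.image_eq_range]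
        congr 1
        funext n
        rw [pushState_pushState, pushState_pushState]
        congr 1
        ext f
        exact (smul_val_eq_conj_smul _ f (hNγ n)).symm
      rw [himg] at hw
      obtain ⟨ψ', hψ', hψ'w⟩ := exists_mem_closure_pushState (stateOrbit_subset (hCs hψ)) _ hw
      refine ⟨N, inferInstance, ?_, ψ',
        closure_stateOrbit_trans (fun _ _ => Subgroup.mem_top _) hψ hψ', ?_⟩
      · intro γ' hγ' n hn
        rcases Finset.mem_insert.1 hγ' with rfl | h
        · exact hNγ ⟨n, hn⟩
        · exact hconj γ' h n hn.1
      · intro γ' hγ'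
        rcases Finset.mem_insert.1 hγ' with rfl | h
        · exact ⟨w, hψ'w.symm⟩
        · refine closure_minimal ?_ (hD γ') hψ'
          rintro _ ⟨n, hn, rfl⟩
          obtain ⟨y, hy⟩ := hψD γ' h
          refine ⟨(⟨_, hconj γ' h n hn.1⟩ : H) • y, ?_⟩
          rw [← pushState_smulMap_evalState, hy,
            pushState_pushState, pushState_pushState]
          congr 1
          ext f
          exact (smul_val_eq_conj_smul n f (hconj γ' h n hn.1)).symm
  obtain ⟨ψ, hψC, hψD⟩ := IsCompact.inter_iInter_nonempty (s := C)
    (isCompact_stateSpace.of_isClosed_subset isClosed_closure hCs) D hD fun F => by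
      obtain ⟨-, -, -, ψ, hψ, hψD⟩ := hfin F
      exact ⟨ψ, hψ, Set.mem_iInter₂.2 hψD⟩
  obtain ⟨z, hz⟩ := stateSupport_nonempty (hCs hψC)
  refine ⟨z, ?_⟩
  -- If all coordinates are point masses, the support is a single point.
  rwa [← eq_evalState_of_support_subset (hCs hψC) (y := z) fun z' hz' => Subtype.ext ?_]
  funext γ
  obtain ⟨y, hy⟩ := Set.mem_iInter.1 hψD γ
  exact (apply_eq_of_mem_stateSupport hy.symm hz').trans
    (apply_eq_of_mem_stateSupport hy.symm hz).symm

end Coinduced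

end Coinduction

/-! ### The extended action -/

section Extension

variable {Γ X B : Type u} [Group Γ] {H : Subgroup Γ}
  [TopologicalSpace X] [CompactSpace X] [T2Space X] [MulAction Γ X] [ContinuousConstSMul Γ X]
  [TopologicalSpace B] [CompactSpace B] [T2Space B] [MulAction H B] [ContinuousConstSMul H B]

omit [ContinuousConstSMul Γ X] in
theorem IsGenFurstenbergBoundary.isContracting {π : C(B, X)}
    (hπ : IsGenFurstenbergBoundary H π) : IsContracting (Set.univ : Set H) π :=
  hπ.boundary.stronglyProximal.isContracting

omit [TopologicalSpace X] [CompactSpace X] [T2Space X] [ContinuousConstSMul Γ X] [CompactSpace B]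
  [T2Space B] [ContinuousConstSMul H B] in
theorem IsExtendedAction.map_smul {π : B → X} {T : Γ →* (B ≃ₜ B)} (hT : IsExtendedAction H π T)
    (g : Γ) (n : H) (hn : g * n * g⁻¹ ∈ H) (b : B) : T g (n • b) = (⟨_, hn⟩ : H) • T g b := by
  rw [← hT.extend, ← hT.extend, ← Homeomorph.mul_apply, ← Homeomorph.mul_apply, ← map_mul,
    ← map_mul]
  simp

/-- The canonical lift of the elements of `Γ` to continuous maps of the boundary. -/
theorem exists_conj_equivariant_lift (hH : IsCommensurated H) (hmin : MulAction.IsMinimal H X)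
    {π : C(B, X)} (hπ : IsGenFurstenbergBoundary H π) :
    ∃ S : Γ → B → B, (∀ g, Continuous (S g)) ∧ (∀ (h : H) b, S h b = h • b) ∧
      (∀ g b, π (S g b) = g • π b) ∧
      ∀ (g : Γ) (n : H) (hn : g * n * g⁻¹ ∈ H) b, S g (n • b) = (⟨_, hn⟩ : H) • S g b := by
  rcases isEmpty_or_nonempty B with hB | hB
  · exact ⟨fun _ => id, fun _ => continuous_id, fun _ b => hB.elim b, fun _ b => hB.elim b,
      fun _ _ _ b => hB.elim b⟩
  have hc := hπ.isContracting
  have := hπ.boundary.minimal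
  have := Coinduced.compactSpace (H := H) π.continuous
  have := Coinduced.nonempty hπ.boundary.factor.surjective hπ.boundary.factor.map_smul
  obtain ⟨σ, hσ, hσH, hσp⟩ := hπ.exists_map (π.comp (Coinduced.eval 1 : C(Coinduced H π, B)))
    (fun h f => by
      change π (f.1 (1 * h)) = (h : Γ) • π (f.1 1)
      rw [one_mul, f.2.2]) (Coinduced.isContracting hH hc)
  -- Rigidity, as this is an `H`-map over `X`; it makes evaluation at `h ∈ H` the given action.
  have h1 : (fun b => (σ b).1 1) = id := by
    refine eq_of_conj_equivariant hH hc 1 ⊤ (fun n _ => by simp)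
      ((Coinduced.eval 1).continuous.comp hσ) continuous_id (fun n _ b => ?_) (fun n _ b => ?_)
      fun b => hσp b
    · rw [hσH]
      exact Coinduced.smul_val_eq_conj_smul n (σ b) _
    · change n • b = (_ : H) • b
      congr 1
      exact Subtype.ext (by simp)
  refine ⟨fun g b => (σ b).1 g, fun g => (Coinduced.eval g).continuous.comp hσ, fun h b => ?_,
    fun g b => ?_, fun g n hn b => ?_⟩
  · change (σ b).1 h = h • b
    rw [Coinduced.val_smul]
    exact congr_arg (h • ·) (congr_fun h1 b)
  · change π ((σ b).1 g) = g • π b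
    rw [(σ b).2.2]
    exact congr_arg (g • ·) (hσp b)
  · change (σ (n • b)).1 g = _
    rw [hσH]
    exact Coinduced.smul_val_eq_conj_smul n (σ b) hn

/-- Both `S (g * g')` and `S g ∘ S g'` intertwine a finite-index subgroup with its conjugate by `g *
g'`, so rigidity makes the lifts multiplicative. -/
theorem exists_extendedAction (hH : IsCommensurated H) (hmin : MulAction.IsMinimal H X)
    {π : C(B, X)} (hπ : IsGenFurstenbergBoundary H π) :
    ∃ T : Γ →* (B ≃ₜ B), IsExtendedAction H π T := by
  obtain ⟨S, hS, hSH, hSπ, hSc⟩ := exists_conj_equivariant_lift hH hmin hπ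
  have hc := hπ.isContracting
  have := hπ.boundary.minimal
  have hone : ∀ b, S 1 b = b := fun b => by simpa using hSH 1 b
  have hmul : ∀ g g' b, S (g * g') b = S g (S g' b) := by
    intro g g'
    have := hH.finiteIndex_conjInter g'
    have := hH.finiteIndex_conjInter (g * g')
    refine congr_fun (eq_of_conj_equivariant hH hc (g * g')
      ((conjInter H g').subgroupOf H ⊓ (conjInter H (g * g')).subgroupOf H)
      (fun n hn => (mem_conjInter.1 hn.2).2) (hS _) ((hS g).comp (hS g'))
      (fun n hn b => hSc _ n _ b) (fun n hn b => ?_)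
      (fun b => by rw [hSπ, hSπ, hSπ, mul_smul]))
    have h' : g' * n * g'⁻¹ ∈ H := (mem_conjInter.1 hn.1).2
    have e : g * (⟨_, h'⟩ : H) * g⁻¹ = g * g' * n * (g * g')⁻¹ := by simp [mul_assoc]
    rw [hSc g' n h' b, hSc g ⟨_, h'⟩ (e ▸ (mem_conjInter.1 hn.2).2)]
    congr 1
    exact Subtype.ext e
  have hinv : ∀ g b, S g⁻¹ (S g b) = b := fun g b => by rw [← hmul, inv_mul_cancel, hone]
  have hinv' : ∀ g b, S g (S g⁻¹ b) = b := fun g b => by rw [← hmul, mul_inv_cancel, hone]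
  let T : Γ →* (B ≃ₜ B) :=
    { toFun := fun g => ⟨⟨S g, S g⁻¹, hinv g, hinv' g⟩, hS g, hS g⁻¹⟩
      map_one' := Homeomorph.ext hone
      map_mul' := fun g g' => Homeomorph.ext (hmul g g') }
  exact ⟨T, ⟨hSH, hSπ⟩⟩

omit [ContinuousConstSMul Γ X] in
theorem IsExtendedAction.eq (hH : IsCommensurated H) {π : C(B, X)}
    (hπ : IsGenFurstenbergBoundary H π) {T T' : Γ →* (B ≃ₜ B)} (hT : IsExtendedAction H π T)
    (hT' : IsExtendedAction H π T') : T = T' := by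
  have := hπ.boundary.minimal
  ext g b
  have := hH.finiteIndex_conjInter g
  refine congr_fun (eq_of_conj_equivariant hH hπ.isContracting g ((conjInter H g).subgroupOf H)
    (fun n hn => (mem_conjInter.1 hn).2) (T g).continuous (T' g).continuous
    (fun n _ b => hT.map_smul g n _ b) (fun n _ b => hT'.map_smul g n _ b)
    fun b => by rw [hT.equivariant, hT'.equivariant]) b

end Extension

/-! ### Fixed points of homeomorphisms of extremally disconnected spaces -/

/-- The fixed point set of a homeomorphism of a Hausdorff extremally disconnected space is open. -/
theorem isOpen_fixedPoints_of_extremallyDisconnected {B : Type*} [TopologicalSpace B] [T2Space B]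
    [ExtremallyDisconnected B] (T : B ≃ₜ B) : IsOpen {b | T b = b} := by
  obtain ⟨U, hU⟩ := zorn_subset {U : Set B | IsOpen U ∧ Disjoint U (T ⁻¹' U)} (by
    intro c hc hchain
    refine ⟨⋃₀ c, ⟨isOpen_sUnion fun s hs => (hc hs).1, ?_⟩,
      fun s hs => Set.subset_sUnion_of_mem hs⟩
    rw [Set.disjoint_left]
    rintro b ⟨s, hs, hbs⟩ ⟨t, ht, hbt⟩
    rcases hchain.total hs ht with h | h
    · exact Set.disjoint_left.1 (hc ht).2 (h hbs) hbt
    · exact Set.disjoint_left.1 (hc hs).2 hbs (h hbt))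
  have hUo := hU.prop.1
  have hUd := hU.prop.2
  -- The closure of `U` is open and still disjoint from its preimage, so maximality absorbs it.
  have hUc : IsClosed U := by
    have hcl : closure U ⊆ U := by
      refine hU.le_of_ge ⟨ExtremallyDisconnected.open_closure U hUo, ?_⟩ subset_closure
      rw [T.preimage_closure]
      exact (hUd.closure_left (hUo.preimage T.continuous)).closure_right
        (ExtremallyDisconnected.open_closure U hUo)
    exact closure_subset_iff_isClosed.1 hcl
  have key : {b | T b = b} = (U ∪ T ⁻¹' U ∪ T.symm ⁻¹' U)ᶜ := by
    ext b
    simp only [Set.mem_ofPred_eq, Set.mem_compl_iff, Set.mem_union, Set.mem_preimage, not_or]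
    constructor
    · intro hb
      have hbU : b ∉ U := fun h => Set.disjoint_left.1 hUd h (by rwa [Set.mem_preimage, hb])
      have hb' : T.symm b = b := by rw [T.symm_apply_eq, hb]
      rw [hb, hb']
      exact ⟨⟨hbU, hbU⟩, hbU⟩
    · rintro ⟨⟨h1, h2⟩, h3⟩
      by_contra hne
      obtain ⟨P, Q, hP, hQ, hbP, hbQ, hPQ⟩ := t2_separation (Ne.symm hne)
      -- A moved point outside the three sets has a neighbourhood that could be added to `U`.
      set V := (P ∩ T ⁻¹' Q) ∩ (U ∪ T ⁻¹' U ∪ T.symm ⁻¹' U)ᶜ with hV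
      have hVo : IsOpen V := (hP.inter (hQ.preimage T.continuous)).inter
        ((hUc.union (hUc.preimage T.continuous)).union
          (hUc.preimage T.symm.continuous)).isOpen_compl
      have hbV : b ∈ V := ⟨⟨hbP, hbQ⟩, by simp [h1, h2, h3]⟩
      have hmem : U ∪ V ⊆ U := by
        refine hU.le_of_ge ⟨hUo.union hVo, ?_⟩ Set.subset_union_left
        rw [Set.disjoint_left]
        rintro c (hc | hc) (hc' | hc')
        · exact Set.disjoint_left.1 hUd hc hc'
        · exact hc'.2 (Or.inr (by simpa using hc))
        · exact hc.2 (Or.inl (Or.inr hc'))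
        · exact Set.disjoint_left.1 hPQ hc'.1.1 hc.1.2
      exact h1 (hmem (Or.inr hbV))
  rw [key]
  exact ((hUc.union (hUc.preimage T.continuous)).union
    (hUc.preimage T.symm.continuous)).isOpen_compl

/-! ### The boundary is extremally disconnected -/

section Cover

variable {G B : Type u} [Group G] [TopologicalSpace B] [MulAction G B]

/-- The set `U` or the exterior of `U`. -/
def openSide (U : Set B) : Bool → Set B
  | true => U
  | false => (closure U)ᶜ

/-- The cover of a `G`-space which separates the translates of an open set from their exteriors. -/
abbrev SplitCover (G : Type u) [Group G] [MulAction G B] (U : Set B) : Type u :=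
  {x : B × (G → Bool) //
    ∀ F : Finset G, x.1 ∈ closure {c | ∀ h ∈ F, h • c ∈ openSide U (x.2 h)}}

namespace SplitCover

variable {U : Set B}

theorem mem_openSide_unique {b : B} {s t : Bool} (hs : b ∈ openSide U s)
    (ht : b ∈ openSide U t) : s = t := by
  cases s <;> cases t
  · rfl
  · exact absurd (subset_closure ht) hs
  · exact absurd (subset_closure hs) ht
  · rfl

theorem isOpen_openSide (hU : IsOpen U) (s : Bool) : IsOpen (openSide U s) := by
  cases s
  · exact isClosed_closure.isOpen_compl
  · exact hU

variable [ContinuousConstSMul G B]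

theorem isOpen_sides (hU : IsOpen U) (F : Finset G) (ω : G → Bool) :
    IsOpen {c : B | ∀ h ∈ F, h • c ∈ openSide U (ω h)} := by
  simp only [Set.ofPred_forall]
  exact isOpen_biInter_finset fun h _ =>
    (isOpen_openSide hU (ω h)).preimage (continuous_const_smul h)

instance : MulAction G (SplitCover G U) where
  smul g x := ⟨(g • x.1.1, fun h => x.1.2 (h * g)), fun F => by
    classical
    change g • x.1.1 ∈ closure {c | ∀ h ∈ F, h • c ∈ openSide U (x.1.2 (h * g))}
    refine map_mem_closure (continuous_const_smul g) (x.2 (F.image (· * g))) fun c hc h hh => ?_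
    rw [smul_smul]
    exact hc (h * g) (Finset.mem_image_of_mem _ hh)⟩
  one_smul x := Subtype.ext (Prod.ext (one_smul G x.1.1)
    (funext fun h => congr_arg x.1.2 (mul_one h)))
  mul_smul g k x := Subtype.ext (Prod.ext (mul_smul g k x.1.1)
    (funext fun h => congr_arg x.1.2 (mul_assoc h g k).symm))

instance : ContinuousConstSMul G (SplitCover G U) := by
  refine ⟨fun g => continuous_induced_rng.2 (Continuous.prodMk ?_ (continuous_pi fun h => ?_))⟩
  · exact (continuous_const_smul g).comp (continuous_fst.comp continuous_subtype_val)
  · exact (continuous_apply (h * g)).comp (continuous_snd.comp continuous_subtype_val)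

/-- The covering map. -/
def proj : C(SplitCover G U, B) := ⟨fun x => x.1.1, continuous_fst.comp continuous_subtype_val⟩

omit [ContinuousConstSMul G B] in
theorem isOpen_agree {ι : Type*} (F : Finset ι) (ω : ι → Bool) :
    IsOpen {ω' : ι → Bool | ∀ h ∈ F, ω' h = ω h} := by
  simp only [Set.ofPred_forall]
  exact isOpen_biInter_finset fun h _ =>
    (isOpen_discrete {ω h}).preimage (continuous_apply (A := fun _ => Bool) h)

omit [ContinuousConstSMul G B] in
theorem compactSpace [CompactSpace B] : CompactSpace (SplitCover G U) := by
  have h : IsClosed {x : B × (G → Bool) |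
      ∀ F : Finset G, x.1 ∈ closure {c | ∀ h ∈ F, h • c ∈ openSide U (x.2 h)}} := by
    rw [Set.ofPred_forall]
    refine isClosed_iInter fun F => ?_
    -- For fixed `F` the condition involves finitely many discrete coordinates, so it is locally
    -- constant in the second variable.
    rw [← isOpen_compl_iff, isOpen_iff_mem_nhds]
    rintro ⟨b, ω⟩ hb
    refine Filter.mem_of_superset (prod_mem_nhds (isClosed_closure.isOpen_compl.mem_nhds hb)
      ((isOpen_agree F ω).mem_nhds fun _ _ => rfl)) ?_
    rintro ⟨c, ω'⟩ ⟨hc, hω'⟩ hmem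
    have hsub : {d : B | ∀ h ∈ F, h • d ∈ openSide U (ω' h)} ⊆
        {d | ∀ h ∈ F, h • d ∈ openSide U (ω h)} := fun d hd h hh => by
      rw [← hω' h hh]
      exact hd h hh
    exact hc (closure_mono hsub hmem)
  exact isCompact_iff_compactSpace.1 h.isCompact

/-- An ultrafilter converging to `b` and containing all dense open sets chooses a side for every
translate at once. -/
theorem proj_surjective (hU : IsOpen U) : Function.Surjective (proj : C(SplitCover G U, B)) := by
  intro b
  let l : Filter B :=
    { sets := {A | ∃ D, IsOpen D ∧ Dense D ∧ D ⊆ A}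
      univ_sets := ⟨Set.univ, isOpen_univ, dense_univ, subset_rfl⟩
      sets_of_superset := fun ⟨D, h1, h2, h3⟩ h => ⟨D, h1, h2, h3.trans h⟩
      inter_sets := fun ⟨D, h1, h2, h3⟩ ⟨E, k1, k2, k3⟩ =>
        ⟨D ∩ E, h1.inter k1, h2.inter_of_isOpen_left k2 h1, Set.inter_subset_inter h3 k3⟩ }
  have hne : (nhds b ⊓ l).NeBot := by
    rw [Filter.inf_neBot_iff]
    rintro A hA A' ⟨D, -, hD, hDA⟩
    exact ((mem_closure_iff_nhds.1 (hD b)) A hA).mono (Set.inter_subset_inter_right _ hDA)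
  let p := Ultrafilter.of (nhds b ⊓ l)
  have hp : (p : Filter B) ≤ nhds b ⊓ l := Ultrafilter.of_le _
  have hside : ∀ h : G, ∃ s : Bool, ∀ᶠ c in (p : Filter B), h • c ∈ openSide U s := by
    intro h
    have hdense : ∀ᶠ c in (p : Filter B), h • c ∈ U ∪ (closure U)ᶜ := by
      refine (hp.trans inf_le_right) ⟨(h • ·) ⁻¹' (U ∪ (closure U)ᶜ), ?_, ?_, subset_rfl⟩
      · exact (hU.union isClosed_closure.isOpen_compl).preimage (continuous_const_smul h)
      · refine Dense.preimage ?_ (Homeomorph.smul h).isOpenMap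
        intro c
        by_cases hc : c ∈ closure U
        · exact closure_mono Set.subset_union_left hc
        · exact subset_closure (Or.inr hc)
    rcases Ultrafilter.eventually_or.1 hdense with h | h
    · exact ⟨true, h⟩
    · exact ⟨false, h⟩
  choose ω hω using hside
  refine ⟨⟨(b, ω), fun F => ?_⟩, rfl⟩
  refine mem_closure_of_frequently_of_tendsto (f := id) (b := (p : Filter B)) ?_
    (hp.trans inf_le_left)
  exact ((Filter.eventually_all_finset F).2 fun h _ => hω h).frequently

/-- Every nonempty open subset of the cover contains the preimage of a nonempty open set. -/
theorem exists_preimage_subset (hU : IsOpen U) {V : Set (SplitCover G U)} (hV : IsOpen V)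
    (hne : V.Nonempty) : ∃ W : Set B, IsOpen W ∧ W.Nonempty ∧ proj ⁻¹' W ⊆ V := by
  obtain ⟨x, hx⟩ := hne
  obtain ⟨V', hV', rfl⟩ := isOpen_induced_iff.1 hV
  obtain ⟨P, Q, hP, hQ, hxP, hxQ, hPQ⟩ := isOpen_prod_iff.1 hV' x.1.1 x.1.2 hx
  obtain ⟨F, v, hv, hF⟩ := isOpen_pi_iff.1 hQ _ hxQ
  refine ⟨P ∩ {c | ∀ h ∈ F, h • c ∈ openSide U (x.1.2 h)}, hP.inter (isOpen_sides hU F _),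
    mem_closure_iff.1 (x.2 F) P hP hxP, ?_⟩
  rintro y ⟨hyP, hyF⟩
  refine hPQ ⟨hyP, hF fun h hh => ?_⟩
  -- A common point `c` forces the signs of `y` and `x` to agree on `F`.
  obtain ⟨c, hc1, hc2⟩ := mem_closure_iff.1 (y.2 F) _ (isOpen_sides hU F x.1.2) hyF
  rw [mem_openSide_unique (hc2 h hh) (hc1 h hh)]
  exact (hv h hh).2

/-- After contraction in `B`, the state sits over one point `b`. Minimality moves `b` into an open
set whose whole preimage lies in a given neighbourhood of `z`. -/
theorem isContracting [CompactSpace B] [T2Space B] [MulAction.IsMinimal G B] (hU : IsOpen U)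
    {X : Type u} [TopologicalSpace X] {π : C(B, X)}
    (hc : IsContracting (Set.univ : Set G) π) :
    IsContracting (Set.univ : Set G) (π.comp (proj : C(SplitCover G U, B))) := by
  have := compactSpace (G := G) (U := U)
  intro φ hφ x hx
  obtain ⟨b, hb⟩ := hc (pushState proj φ) (pushState_mem hφ proj) x hx
  have himg : stateOrbit (Set.univ : Set G) (pushState proj φ) =
      pushState (proj : C(SplitCover G U, B)) '' stateOrbit (Set.univ : Set G) φ := by
    simp only [stateOrbit, Set.image_image]
    rfl
  rw [himg] at hb
  obtain ⟨ψ, hψ, hψb⟩ := exists_mem_closure_pushState (stateOrbit_subset hφ) _ hb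
  have hψs := closure_stateOrbit_subset hφ hψ
  obtain ⟨z, -⟩ := stateSupport_nonempty hψs
  rw [← Subgroup.coe_top] at hψ ⊢
  refine ⟨z, closure_stateOrbit_trans subset_rfl hψ
    (evalState_mem_closure (stateOrbit_subset hψs) fun V hV hz => ?_)⟩
  obtain ⟨W, hW, hWne, hWV⟩ := exists_preimage_subset hU hV ⟨z, hz⟩
  obtain ⟨g, hg⟩ := hW.exists_smul_mem G b hWne
  refine ⟨_, ⟨g, trivial, rfl⟩, fun y hy => hWV ?_⟩
  have : pushState (proj : C(SplitCover G U, B)) (pushState (smulMap _ g) ψ) =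
      evalState (g • b) := by
    rw [← pushState_smulMap_evalState, ← hψb]
    rfl
  rwa [Set.mem_preimage, apply_eq_of_mem_stateSupport this hy]

end SplitCover

/-- The generalized Furstenberg boundary is extremally disconnected. -/
theorem IsGenFurstenbergBoundary.extremallyDisconnected {X : Type u} [CompactSpace B] [T2Space B]
    [ContinuousConstSMul G B] [TopologicalSpace X] [CompactSpace X] [T2Space X] [MulAction G X]
    [ContinuousConstSMul G X] [MulAction.IsMinimal G X] {π : C(B, X)}
    (hπ : IsGenFurstenbergBoundary G π) : ExtremallyDisconnected B := by
  refine ⟨fun U hU => ?_⟩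
  rcases isEmpty_or_nonempty B with hB | ⟨⟨b₀⟩⟩
  · rw [Set.eq_empty_of_isEmpty (closure U)]
    exact isOpen_empty
  have hc : IsContracting (Set.univ : Set G) π := hπ.boundary.stronglyProximal.isContracting
  have := hπ.boundary.minimal
  have := SplitCover.compactSpace (G := G) (U := U)
  have : Nonempty (SplitCover G U) := ⟨(SplitCover.proj_surjective hU b₀).choose⟩
  obtain ⟨σ, hσ, hσG, hσπ⟩ := hπ.exists_map (π.comp (SplitCover.proj : C(SplitCover G U, B)))
    (fun g x => hπ.boundary.factor.map_smul g _) (SplitCover.isContracting hU hc)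
  have hid : (fun b => (σ b).1.1) = id := by
    refine eq_of_contracting (⊤ : Subgroup G) π (fun n => smulMap B (n : G))
      (fun θ hθ x hx => ?_) (SplitCover.proj.continuous.comp hσ) continuous_id
      (fun n b => ?_) (fun n b => rfl) fun b => hσπ b
    · obtain ⟨w, hw⟩ := hc θ hθ x hx
      refine ⟨w, closure_mono ?_ hw⟩
      rintro _ ⟨g, -, rfl⟩
      exact ⟨⟨g, trivial⟩, rfl⟩
    · exact congr_arg (fun x => x.1.1) (hσG n b)
  -- The sign at the identity, read along the section `σ`, is continuous and detects the closure of
  -- `U`.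
  have hcl : closure U = {b | (σ b).1.2 1 = true} := by
    have hclosed : IsClopen {b | (σ b).1.2 1 = true} :=
      (isClopen_discrete {true}).preimage
        ((continuous_apply 1).comp (continuous_snd.comp (continuous_subtype_val.comp hσ)))
    refine subset_antisymm (closure_minimal (fun b hb => ?_) hclosed.1) fun b hb => ?_
    · have hmem := (σ b).2 {1}
      rw [show (σ b).1.1 = b from congr_fun hid b] at hmem
      obtain ⟨c, hcU, hc1⟩ := mem_closure_iff.1 hmem U hU hb
      have := hc1 1 (Finset.mem_singleton_self 1)
      rw [one_smul] at this
      exact SplitCover.mem_openSide_unique this (t := true) hcU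
    · have hmem := (σ b).2 {1}
      rw [show (σ b).1.1 = b from congr_fun hid b] at hmem
      refine closure_mono (fun c hc1 => ?_) hmem
      have := hc1 1 (Finset.mem_singleton_self 1)
      rwa [one_smul, show (σ b).1.2 1 = true from hb] at this
  rw [hcl]
  exact (isOpen_discrete {true}).preimage
    ((continuous_apply 1).comp (continuous_snd.comp (continuous_subtype_val.comp hσ)))

end Cover

/-! ### Fixed points of the extended action -/

section Fixed

variable {Γ X B : Type u} [Group Γ] {H : Subgroup Γ}
  [TopologicalSpace B] [MulAction H B]

/-- If the action of `H` is free, then `g` commutes with the return times of its fixed points. -/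
theorem IsExtendedAction.commute_of_mem_returnTimes [MulAction Γ X] {π : B → X}
    {T : Γ →* (B ≃ₜ B)} (hT : IsExtendedAction H π T)
    (hfree : ∀ (h : H) (y : B), h • y = y → h = 1) {g k : Γ}
    (hk : k ∈ returnTimes T (conjInter H g) (fixSet T g)) : g * k = k * g := by
  obtain ⟨hkK, _, ⟨y, hy, rfl⟩, hky⟩ := hk
  obtain ⟨hkH, hkg⟩ := mem_conjInter.1 hkK
  have h1 : (⟨g * k * g⁻¹, hkg⟩ : H) • y = (⟨k, hkH⟩ : H) • y := by
    have := hT.map_smul g ⟨k, hkH⟩ hkg y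
    rw [show T g y = y from hy] at this
    rw [← this, ← hT.extend]
    exact hky
  have h2 := hfree ((⟨k, hkH⟩ : H)⁻¹ * ⟨g * k * g⁻¹, hkg⟩) y (by rw [mul_smul, h1, inv_smul_smul])
  have h3 : g * k * g⁻¹ = k := congr_arg Subtype.val (inv_mul_eq_one.1 h2).symm
  rwa [mul_inv_eq_iff_eq_mul] at h3

/-- Commuting with generators suffices, so the two alternatives of the theorem differ only in
whether fixed points exist. -/
theorem IsExtendedAction.mem_centralizer [MulAction Γ X] {π : B → X}
    {T : Γ →* (B ≃ₜ B)} (hT : IsExtendedAction H π T)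
    (hfree : ∀ (h : H) (y : B), h • y = y → h = 1) (g : Γ) :
    g ∈ Subgroup.centralizer (returnTimeGroup T (conjInter H g) (fixSet T g) : Set Γ) := by
  rw [returnTimeGroup, Subgroup.centralizer_closure]
  exact Subgroup.mem_centralizer_iff.2 fun k hk => (hT.commute_of_mem_returnTimes hfree hk).symm

theorem returnTimeGroup_le (T : Γ →* (B ≃ₜ B)) (K : Subgroup Γ) (U : Set B) :
    returnTimeGroup T K U ≤ K :=
  (Subgroup.closure_le K).2 fun _ hk => hk.1

variable [CompactSpace B] [ContinuousConstSMul H B] [MulAction.IsMinimal H B]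

/-- The group generated by the return times of a nonempty open set has finite index. -/
theorem finiteIndex_returnTimeGroup [MulAction Γ X] {π : B → X}
    {T : Γ →* (B ≃ₜ B)} (hT : IsExtendedAction H π T) (K : Subgroup Γ)
    [(K.subgroupOf H).FiniteIndex] {U : Set B} (hU : IsOpen U) (hne : U.Nonempty) :
    ((returnTimeGroup T K U).subgroupOf H).FiniteIndex := by
  obtain ⟨y, hy⟩ := hne
  set N := (K.subgroupOf H).normalCore with hN
  set L := (returnTimeGroup T K U).subgroupOf H with hL
  -- Every point of the `N`-orbit closure of `y` has an `N`-translate in `U`, so finitely many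
  -- preimages of `U` cover it.
  obtain ⟨t, ht⟩ := (isClosed_closure (s := MulAction.orbit N y)).isCompact.elim_finite_subcover
    (fun n : N => (n • ·) ⁻¹' U) (fun n => hU.preimage (continuous_const_smul n)) fun z hz => by
      obtain ⟨_, hzU, n, rfl⟩ := mem_closure_iff.1 (mem_closure_orbit_symm N hz) U hU hy
      exact Set.mem_iUnion.2 ⟨n, hzU⟩
  -- If `n • y` lies in the preimage of `U` under `m`, then `m * n` is a return time; so finitely
  -- many cosets exhaust `N`.
  have key : ∀ n : N, ∃ m ∈ t, (m * n : H) ∈ L := by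
    intro n
    obtain ⟨m, hm, hmU⟩ := Set.mem_iUnion₂.1 (ht (subset_closure ⟨n, rfl⟩))
    refine ⟨m, hm, Subgroup.subset_closure ⟨?_, _, ⟨y, hy, rfl⟩, ?_⟩⟩
    · exact Subgroup.mem_subgroupOf.1 ((K.subgroupOf H).normalCore_le (m * n).2)
    · change T ((m * n : H) : Γ) y ∈ U
      rw [hT.extend, mul_smul]
      exact hmU
  have hfin : Finite (N ⧸ L.subgroupOf N) := by
    refine Finite.of_surjective (fun m : t => ((m⁻¹ : N) : N ⧸ L.subgroupOf N)) fun q => ?_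
    induction q using QuotientGroup.induction_on with
    | H n =>
      obtain ⟨m, hm, hmn⟩ := key n
      refine ⟨⟨m, hm⟩, QuotientGroup.eq.2 ?_⟩
      rw [inv_inv]
      exact hmn
  refine ⟨?_⟩
  have h1 : L.relIndex N ≠ 0 :=
    (Subgroup.finiteIndex_of_finite_quotient (H := L.subgroupOf N)).index_ne_zero
  rw [← Subgroup.relIndex_top_right]
  refine Subgroup.relIndex_ne_zero_trans h1 ?_
  rw [Subgroup.relIndex_top_right]
  exact Subgroup.FiniteIndex.index_ne_zero

variable [T2Space B] [TopologicalSpace X] [CompactSpace X] [T2Space X] [MulAction Γ X]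

/-- An element which acts trivially on the base and centralizes a subgroup of finite index acts
trivially. -/
theorem IsExtendedAction.apply_eq_self (hH : IsCommensurated H) {π : C(B, X)}
    (hπ : IsGenFurstenbergBoundary H π) {T : Γ →* (B ≃ₜ B)} (hT : IsExtendedAction H π T)
    {g : Γ} (hg : ∀ x : X, g • x = x) (L : Subgroup Γ) [(L.subgroupOf H).FiniteIndex]
    (hL : g ∈ Subgroup.centralizer (L : Set Γ)) (y : B) : T g y = y := by
  have hconj : ∀ n ∈ L.subgroupOf H, g * n * g⁻¹ = n := fun n hn => by
    rw [← Subgroup.mem_centralizer_iff.1 hL n hn, mul_inv_cancel_right]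
  have hmem : ∀ n ∈ L.subgroupOf H, g * n * g⁻¹ ∈ H := fun n hn => (hconj n hn).symm ▸ n.2
  -- Centralizing removes the twist by conjugation, so the identity is a competitor of `T g`.
  refine congr_fun (eq_of_conj_equivariant hH hπ.isContracting g (L.subgroupOf H) hmem
    (T g).continuous continuous_id (fun n hn b => hT.map_smul g n _ b) (fun n hn b => ?_)
    fun b => by rw [hT.equivariant, hg, id]) y
  simp only [id]
  congr 1
  exact Subtype.ext (hconj n hn).symm

end Fixed

theorem mainTheorem7 {Γ X B : Type u} [Group Γ] (H : Subgroup Γ) (hH : IsCommensurated H)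
    [TopologicalSpace X] [CompactSpace X] [T2Space X] [MulAction Γ X] [ContinuousConstSMul Γ X]
    (hmin : MulAction.IsMinimal H X)
    [TopologicalSpace B] [CompactSpace B] [T2Space B] [MulAction H B] [ContinuousConstSMul H B]
    (π : B → X) (hπ : IsGenFurstenbergBoundary H π)
    (hfree : ∀ (h : H) (y : B), h • y = y → h = 1) :
    (∃! T : Γ →* (B ≃ₜ B), IsExtendedAction H π T) ∧
    ∀ T : Γ →* (B ≃ₜ B), IsExtendedAction H π T → ∀ g : Γ,
      Xor (fixSet T g = ∅)
        ((fixSet T g).Nonempty ∧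
          g ∈ Subgroup.centralizer
            (returnTimeGroup T (conjInter H g) (fixSet T g) : Set Γ)) ∧
      (PreconnectedSpace X → (fixSet T g).Nonempty →
        returnTimeGroup T (conjInter H g) (fixSet T g) = conjInter H g) ∧
      ((∀ x : X, g • x = x) → (fixSet T g).Nonempty →
        g ∈ Subgroup.centralizer
            (returnTimeGroup T (conjInter H g) (fixSet T g) : Set Γ) →
        ∀ y : B, T g y = y) := by
  lift π to C(B, X) using hπ.boundary.factor.continuous
  obtain ⟨T₀, hT₀⟩ := exists_extendedAction hH hmin hπ
  refine ⟨⟨T₀, hT₀, fun T hT => hT.eq hH hπ hT₀⟩, fun T hT g => ?_⟩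
  have hcent := hT.mem_centralizer hfree g
  have := hπ.boundary.minimal
  have := hπ.extremallyDisconnected
  have hopen : IsOpen (fixSet T g) := isOpen_fixedPoints_of_extremallyDisconnected (T g)
  have := hH.finiteIndex_conjInter g
  have htriv : (∀ x : X, g • x = x) → (fixSet T g).Nonempty → ∀ y, T g y = y := by
    intro hg hne
    have := finiteIndex_returnTimeGroup hT (conjInter H g) hopen hne
    exact hT.apply_eq_self hH hπ hg _ hcent
  refine ⟨?_, fun hX hne => ?_, fun hg hne _ => htriv hg hne⟩
  · rcases (fixSet T g).eq_empty_or_nonempty with h | h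
    · exact Or.inl ⟨h, fun h' => h'.1.ne_empty h⟩
    · exact Or.inr ⟨⟨h, hcent⟩, h.ne_empty⟩
  · have hfi := finiteIndex_returnTimeGroup hT (conjInter H g) hopen hne
    set L := returnTimeGroup T (conjInter H g) (fixSet T g) with hL
    have hNmin := isMinimal_of_preconnectedSpace (Y := X) (L.subgroupOf H).normalCore
    have hclosed : IsClosed (fixSet T g) := isClosed_eq (T g).continuous continuous_id
    have hg : ∀ x : X, g • x = x := by
      -- `Fix(g)` is `L`-invariant because `g` centralizes `L`; its closed image fills `X` by
      -- minimality of the normal core.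
      have himg : π '' fixSet T g = Set.univ := by
        refine (eq_empty_or_univ_of_smul_invariant_closed (L.subgroupOf H).normalCore
          (hclosed.isCompact.image π.continuous).isClosed ?_).resolve_left (hne.image π).ne_empty
        rintro n _ ⟨_, ⟨y, hy, rfl⟩, rfl⟩
        have hn : ((n : H) : Γ) ∈ L := (L.subgroupOf H).normalCore_le n.2
        refine ⟨T (n : H) y, ?_, hT.equivariant _ _⟩
        change T g (T (n : H) y) = T (n : H) y
        rw [← Homeomorph.mul_apply, ← map_mul, ← Subgroup.mem_centralizer_iff.1 hcent _ hn,
          map_mul, Homeomorph.mul_apply, show T g y = y from hy]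
      intro x
      obtain ⟨y, hy, rfl⟩ := himg.symm ▸ Set.mem_univ x
      rw [← hT.equivariant, show T g y = y from hy]
    have hid := htriv hg hne
    refine le_antisymm (returnTimeGroup_le _ _ _) fun k hk => Subgroup.subset_closure ⟨hk, ?_⟩
    obtain ⟨y, hy⟩ := hne
    exact ⟨T k y, ⟨y, hy, rfl⟩, hid _⟩
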